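/- **Setting.** Let $\rho$ be a measure concentrated on $(0,\infty)$ with $\int\min(1,r)\,\rho(dr)<\infty$, let $\Omega$ be a measurable space with a countable family of measurable sets separating its points (e.g. any standard Borel space), let $G_0$ be a finite, nonzero measure on $\Omega$ with $G_0(\{\omega\})=0$ for every $\omega$, put $\gamma_0=G_0(\Omega)$ and $g_0=G_0/\gamma_0$, and let $\kappa$ be a Markov kernel from $\Omega$ to a measurable space $\mathcal X$. Let $G=\sum_k r_k\delta_{\omega_k}$ (finitely or countably many atoms, the $\omega_k$ with $r_k>0$ being a.s. distinct) be a completely random measure with Lévy measure $\rho(dr)G_0(d\omega)$: $G(\Omega)<\infty$ a.s., $G$ takes independent values on disjoint measurable sets, and $$\mathbb E\,e^{iuG(A)}=\exp\Big\{\int_A\int (e^{iur}-1)\,\rho(dr)\,G_0(d\omega)\Big\}$$ for all real $u$ and measurable $A\subset\Omega$. The *count-mixture model* is: given $(r_k,\omega_k)_k$, draw $m\sim\mathrm{Pois}(G(\Omega))$; given also $m$, draw $z_1,\dots,z_m$ iid from $\sum_k \frac{r_k}{G(\Omega)}\delta_k$; given also these, draw $x_i\sim\kappa(\omega_{z_i})$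 independently for $i=1,\dots,m$. (If $G(\Omega)=0$ then $m=0$.) The occupied atoms are then relabelled $1,\dots,l$ in order of appearance in $z_1,\dots,z_m$, so that $z_i\in\{1,\dots,l\}$; from now on $\boldsymbol z=(z_1,\dots,z_m)$ and $\omega_1,\dots,\omega_l$ denote the relabelled labels and atoms. **Functions.** For $\boldsymbol z\in\{1,\dots,l\}^m$ using all of $1,\dots,l$, numbered in order of appearance, with $n_k=\#\{i:z_i=k\}$, let $$f(\boldsymbol z,m\mid\gamma_0,\rho)=\frac{\gamma_0^l}{m!}\,e^{\gamma_0\int(e^{-r}-1)\rho(dr)}\prod_{k=1}^l\int r^{n_k}e^{-r}\rho(dr),$$ let $$f_M(m\mid\gamma_0,\rho)=\frac1{m!}\,\frac{d^m}{dt^m}\,e^{\gamma_0\int(e^{-(1-t)r}-1)\rho(dr)}\Big|_{t=0},$$ and let $f(\boldsymbol z\mid m,\gamma_0,\rho)=f(\boldsymbol z,m\mid\gamma_0,\rho)/f_M(m\mid\gamma_0,\rho)$ (the exchangeable partition probability function, EPPF). **Corollary (Equivalent Construction).** In the count-mixture model, $f_M(\cdot\mid\gamma_0,\rho)$ is a probability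 mass function and is the marginal law of $m$; the EPPF is nonnegative and, for every $m$ with $f_M(m\mid\gamma_0,\rho)\neq0$, $f(\cdot\mid m,\gamma_0,\rho)$ is a probability mass function and is the conditional law of $\boldsymbol z$ given $m$. Moreover the joint law of $\big(m,\,l,\,\boldsymbol z,\,(\omega_1,\dots,\omega_l),\,(x_1,\dots,x_m)\big)$ in the count-mixture model equals the law produced by the two-step construction: draw $m\sim f_M(m\mid\gamma_0,\rho)$, then $\boldsymbol z\sim f(\boldsymbol z\mid m,\gamma_0,\rho)$; given these, draw $\omega_1,\dots,\omega_l$ iid from $g_0$, and finally $x_i\sim\kappa(\omega_{z_i})$ independently for $i=1,\dots,m$. -/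

import Mathlib

open MeasureTheory ProbabilityTheory
open scoped NNReal ENNReal

noncomputable section

namespace CountMixture

/-! ### Homogeneous completely random measures -/

/-- `ρ` is a Lévy measure on the positive half-line: it charges only `(0, ∞)` and integrates
`min 1 r`. -/
structure IsLevyMeasure (ρ : Measure ℝ) : Prop where
  nonpos_null : ρ (Set.Iic 0) = 0
  lintegral_min_lt_top : ∫⁻ r, ENNReal.ofReal (min 1 r) ∂ρ < ∞

/-- `G` is a completely random measure with Lévy measure `ρ(dr) G₀(dω)`: its values on disjoint
sets are independent, `E[exp(i u G(A))] = exp(∫_A ∫ (exp(i u r) - 1) ρ(dr) G₀(dω))`, and its total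
mass is almost surely finite. -/
structure IsCompletelyRandomMeasure {S Ω : Type*} [MeasurableSpace S] [MeasurableSpace Ω]
    (P : Measure S) (G : S → Measure Ω) (ρ : Measure ℝ) (G₀ : Measure Ω) : Prop where
  measurable_eval : ∀ A : Set Ω, MeasurableSet A → Measurable fun s => G s A
  ae_finite : ∀ᵐ s ∂P, G s Set.univ < ∞
  indep : ∀ (n : ℕ) (A : Fin n → Set Ω), (∀ i, MeasurableSet (A i)) →
    Pairwise (fun i j => Disjoint (A i) (A j)) → iIndepFun (fun i s => G s (A i)) P
  characteristic : ∀ A : Set Ω, MeasurableSet A → ∀ u : ℝ,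
    ∫ s, Complex.exp (Complex.I * (u : ℂ) * ((G s A).toReal : ℂ)) ∂P =
      Complex.exp (∫ _ω in A,
        (∫ r, (Complex.exp (Complex.I * (u : ℂ) * (r : ℂ)) - 1) ∂ρ) ∂G₀)

/-- The measure `∑ₖ rₖ δ_{ωₖ}`. A measure with only `K < ∞` atoms is obtained with `rₖ = 0` for
`k ≥ K`. -/
def atomicMeasure {Ω : Type*} [MeasurableSpace Ω] (r : ℕ → ℝ≥0) (ω : ℕ → Ω) : Measure Ω :=
  Measure.sum fun k => (r k : ℝ≥0∞) • Measure.dirac (ω k)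

/-! ### The count-mixture model -/

/-- The conditional likelihood `f(z, m | G) = Pois(m; G(Ω)) ∏ᵢ r_{zᵢ} / G(Ω)`, where
`G(Ω) = ∑ₖ rₖ`. -/
def likelihood (r : ℕ → ℝ≥0) {m : ℕ} (z : Fin m → ℕ) : ℝ≥0∞ :=
  poissonMeasure (∑' k, r k) {m} * ∏ i, ((r (z i) / ∑' k, r k : ℝ≥0) : ℝ≥0∞)

/-- The random variables `(r, ω, m, z, x)` on `(S, P)` follow the count-mixture model
`xᵢ ∼ κ(ω_{zᵢ})`, `zᵢ ∼ ∑ₖ (rₖ / G(Ω)) δₖ`, `m ∼ Pois(G(Ω))`, `i = 1, …, m`,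
where `G = ∑ₖ rₖ δ_{ωₖ}` (with distinct atoms) is a completely random measure with Lévy measure
`ρ(dr) G₀(dω)`. The field `conditional_law` gives the conditional law of `(m, z₁, …, z_m, x₁, …, x_m)`
given `(rₖ, ωₖ)ₖ`; nothing is said about `zᵢ` and `xᵢ` beyond the sample size. -/
structure IsCountMixture {S Ω X : Type*} [MeasurableSpace S] [MeasurableSpace Ω]
    [MeasurableSpace X] (P : Measure S) (ρ : Measure ℝ) (G₀ : Measure Ω) (κ : Kernel Ω X)
    (r : ℕ → S → ℝ≥0) (ω : ℕ → S → Ω) (m : S → ℕ) (z : ℕ → S → ℕ) (x : ℕ → S → X) : Prop where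
  measurable_weight : ∀ k, Measurable (r k)
  measurable_atom : ∀ k, Measurable (ω k)
  measurable_size : Measurable m
  measurable_label : ∀ i, Measurable (z i)
  measurable_obs : ∀ i, Measurable (x i)
  completelyRandom :
    IsCompletelyRandomMeasure P (fun s => atomicMeasure (fun k => r k s) (fun k => ω k s)) ρ G₀
  distinct : ∀ᵐ s ∂P, ∀ j k, j ≠ k → 0 < r j s → 0 < r k s → ω j s ≠ ω k s
  conditional_law : ∀ (n : ℕ) (y : Fin n → ℕ) (B : Fin n → Set X), (∀ i, MeasurableSet (B i)) →
    ∀ A : Set ((ℕ → ℝ≥0) × (ℕ → Ω)), MeasurableSet A →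
      P {s | (fun k => r k s, fun k => ω k s) ∈ A ∧ m s = n ∧
          (∀ i : Fin n, z i s = y i) ∧ ∀ i : Fin n, x i s ∈ B i} =
        ∫⁻ s in {s | (fun k => r k s, fun k => ω k s) ∈ A},
          likelihood (fun k => r k s) y * ∏ i : Fin n, κ (ω (y i) s) (B i) ∂P

/-! ### Relabelling the clusters in order of appearance

Labels in order of appearance are counted from `0`: they are `0, …, l - 1`. -/

/-- The first index carrying the same label as `i`. -/
def firstIndex {m : ℕ} (z : Fin m → ℕ) (i : Fin m) : Fin m :=
  (Finset.univ.filter fun j => z j = z i).min' ⟨i, by simp⟩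

/-- The indices at which a new label appears. -/
def firstIndices {m : ℕ} (z : Fin m → ℕ) : Finset (Fin m) :=
  Finset.univ.image (firstIndex z)

/-- The number `l` of clusters. -/
def numClusters {m : ℕ} (z : Fin m → ℕ) : ℕ := (firstIndices z).card

/-- The increasing enumeration of the indices at which a new label appears. -/
def appearance {m : ℕ} (z : Fin m → ℕ) : Fin (numClusters z) ≃o firstIndices z :=
  (firstIndices z).orderIsoOfFin rfl

/-- The labels after relabelling in order of appearance. -/
def relabel {m : ℕ} (z : Fin m → ℕ) (i : Fin m) : Fin (numClusters z) :=
  (appearance z).symm ⟨firstIndex z i, Finset.mem_image_of_mem _ (Finset.mem_univ i)⟩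

/-- The original label of the `k`-th cluster in order of appearance. -/
def originalLabel {m : ℕ} (z : Fin m → ℕ) (k : Fin (numClusters z)) : ℕ :=
  z (appearance z k : Fin m)

/-- The labels `z` use exactly `l` values and number them in order of appearance. -/
def IsAppearanceOrdered {m l : ℕ} (z : Fin m → Fin l) : Prop :=
  Function.Surjective z ∧
    ∀ j k : Fin l, j < k → ∃ i, z i = j ∧ ∀ i', z i' = k → i < i'

/-- The space of outcomes `(m, l, z, (ω₁, …, ω_l), (x₁, …, x_m))`: sample size, number of clusters,
labels, atoms of the clusters, observations. -/
abbrev Outcome (Ω X : Type*) : Type _ :=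
  (p : ℕ × ℕ) × ((Fin p.1 → Fin p.2) × (Fin p.2 → Ω) × (Fin p.1 → X))

/-- The labels `(l, z)` of a sample of size `m`. -/
abbrev Labels (m : ℕ) : Type := (l : ℕ) × (Fin m → Fin l)

/-- The outcome of a sample `x₁, …, x_m` with labels `z₁, …, z_m` and atoms `ωₖ`, after relabelling
the occupied atoms in order of appearance. -/
def outcome {Ω X : Type*} {m : ℕ} (ω : ℕ → Ω) (z : Fin m → ℕ) (x : Fin m → X) : Outcome Ω X :=
  ⟨(m, numClusters z), relabel z, fun k => ω (originalLabel z k), x⟩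

/-! ### ECPF, marginal of the sample size, EPPF -/

open scoped Classical in
/-- The exchangeable cluster probability function
`f(z, m | γ₀, ρ) = (γ₀ˡ / m!) exp(γ₀ ∫ (e⁻ʳ - 1) ρ(dr)) ∏ₖ ∫ r^{nₖ} e⁻ʳ ρ(dr)`,
for labels in order of appearance. -/
def ecpf (γ₀ : ℝ) (ρ : Measure ℝ) {m l : ℕ} (z : Fin m → Fin l) : ℝ :=
  if IsAppearanceOrdered z then
    γ₀ ^ l / (m.factorial : ℝ) * Real.exp (γ₀ * ∫ r, (Real.exp (-r) - 1) ∂ρ) *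
      ∏ k : Fin l, ∫ r, r ^ (Finset.univ.filter fun i => z i = k).card * Real.exp (-r) ∂ρ
  else 0

/-- The probability generating function `exp(γ₀ ∫ (e^{-(1-t)r} - 1) ρ(dr))` of the sample size. -/
def sizePGF (γ₀ : ℝ) (ρ : Measure ℝ) (t : ℝ) : ℝ :=
  Real.exp (γ₀ * ∫ r, (Real.exp (-(1 - t) * r) - 1) ∂ρ)

/-- The probability mass function `f_M(m | γ₀, ρ)` of the sample size: the `m`-th Taylor
coefficient at `0` of the probability generating function. -/
def sizePMF (γ₀ : ℝ) (ρ : Measure ℝ) (m : ℕ) : ℝ :=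
  iteratedDeriv m (sizePGF γ₀ ρ) 0 / (m.factorial : ℝ)

/-- The exchangeable partition probability function
`f(z | m, γ₀, ρ) = f(z, m | γ₀, ρ) / f_M(m | γ₀, ρ)`. -/
def eppf (γ₀ : ℝ) (ρ : Measure ℝ) {m l : ℕ} (z : Fin m → Fin l) : ℝ :=
  ecpf γ₀ ρ z / sizePMF γ₀ ρ m

/-! ### The two-step construction -/

/-- The law on `ℕ` with probability mass function `f_M`. -/
def sizeLaw (γ₀ : ℝ) (ρ : Measure ℝ) : Measure ℕ :=
  Measure.sum fun m => ENNReal.ofReal (sizePMF γ₀ ρ m) • Measure.dirac m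

/-- The law of the labels of a sample of size `m` given by the EPPF. -/
def labelLaw (γ₀ : ℝ) (ρ : Measure ℝ) (m : ℕ) : Measure (Labels m) :=
  Measure.sum fun q : Labels m => ENNReal.ofReal (eppf γ₀ ρ q.2) • Measure.dirac q

/-- The base distribution `g₀ = G₀ / γ₀`. -/
def baseLaw {Ω : Type*} [MeasurableSpace Ω] (G₀ : Measure Ω) : Measure Ω :=
  (G₀ Set.univ)⁻¹ • G₀

/-- Independent observations `xᵢ ∼ κ(ω_{zᵢ})` given the atoms `ω₁, …, ω_l`. -/
def observationKernel {Ω X : Type*} [MeasurableSpace Ω] [MeasurableSpace X]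
    (κ : Kernel Ω X) [IsMarkovKernel κ] {m l : ℕ} (z : Fin m → Fin l) :
    Kernel (Fin l → Ω) (Fin m → X) where
  toFun w := Measure.pi fun i => κ (w (z i))
  measurable' := by
    refine Measurable.measure_of_isPiSystem_of_isProbabilityMeasure
      (S := Set.pi Set.univ '' Set.pi Set.univ fun _ : Fin m => {s : Set X | MeasurableSet s})
      generateFrom_pi.symm isPiSystem_pi ?_
    rintro _ ⟨B, hB, rfl⟩
    simp only [Measure.pi_pi]
    exact Finset.measurable_prod _ fun i _ =>
      (κ.measurable_coe (hB i (Set.mem_univ i))).comp (measurable_pi_apply (z i))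

/-- Given the sample size and the labels: atoms `ω₁, …, ω_l` iid from `g₀`, then observations
`xᵢ ∼ κ(ω_{zᵢ})`. -/
def outcomeLaw {Ω X : Type*} [MeasurableSpace Ω] [MeasurableSpace X]
    (G₀ : Measure Ω) (κ : Kernel Ω X) [IsMarkovKernel κ] {m l : ℕ} (z : Fin m → Fin l) :
    Measure (Outcome Ω X) :=
  ((Measure.pi fun _ : Fin l => baseLaw G₀) ⊗ₘ observationKernel κ z).map
    fun wx => ⟨(m, l), z, wx.1, wx.2⟩

/-- The two-step construction: `m ∼ f_M`, then `z ∼ f(z | m)`, then atoms `ωₖ ∼ g₀` and observations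
`xᵢ ∼ κ(ω_{zᵢ})`. -/
def twoStepLaw {Ω X : Type*} [MeasurableSpace Ω] [MeasurableSpace X]
    (ρ : Measure ℝ) (G₀ : Measure Ω) (κ : Kernel Ω X) [IsMarkovKernel κ] :
    Measure (Outcome Ω X) :=
  (sizeLaw (G₀.real Set.univ) ρ).bind fun m =>
    (labelLaw (G₀.real Set.univ) ρ m).bind fun q => outcomeLaw G₀ κ q.2

end CountMixture

end

/-! By analytic continuation, the characteristic function of `G(A)` determines its Laplace
transform. With independence on disjoint sets this gives
`𝔼[∏ₖ G(Dₖ)^{nₖ} e^{-G(Ω)}] = e^{γ₀ψ(-1)} ∏ₖ B_{nₖ}(G₀(Dₖ))` for a partition `(Dₖ)` of `Ω`, where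
`ψ(t) = ∫ (e^{tr} - 1) ρ(dr)` and `Bₙ(a) = e^{-aψ} (d/dt)ⁿ e^{aψ}` at `t = -1` is a Bell polynomial
in `a` with linear coefficient `∫ rⁿ e^{-r} ρ(dr)`. On the event `m = n` the atoms of the
observations have the law `𝔼[e^{-G(Ω)} G^{⊗n}] / n!`. The points whose coordinates coincide exactly
along the labels `z` are exhausted by products of cells of finer and finer finite partitions; as
`g₀` has no atoms, only the linear coefficients of the Bell polynomials survive, and the law
restricted to these points is `f(z, m)` times the product `g₀^{⊗l}`. The weighted atoms being
distinct, coincidences of the sampled atoms are those of the labels, and given the sampled atoms the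
observations are independent draws from `κ`.
-/

noncomputable section

open Filter Topology

namespace CountMixture

/-! ### Product sets and product measures -/

theorem ext_univ_pi {ι : Type*} [Finite ι] {E : ι → Type*} [∀ i, MeasurableSpace (E i)]
    {μ ν : Measure (∀ i, E i)} [IsFiniteMeasure μ]
    (h : ∀ B : ∀ i, Set (E i), (∀ i, MeasurableSet (B i)) →
      μ (Set.univ.pi B) = ν (Set.univ.pi B)) : μ = ν := by
  refine ext_of_generate_finite _ generateFrom_pi.symm isPiSystem_pi ?_ ?_
  · rintro _ ⟨B, hB, rfl⟩
    exact h B fun i => hB i trivial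
  · simpa using h (fun _ => Set.univ) fun _ => .univ

/-! ### Coincidences of coordinates -/

section Coincidence

variable {Ω ι α β : Type*}

/-- The points of `Ω^ι` whose coordinates are identified by `c` exactly as their indices are
identified by `q`. With `c = id` this fixes the pattern of coincidences of the coordinates; finitely
valued `c` serve to approximate that case. -/
def coincidenceSet (c : Ω → β) (q : ι → α) : Set (ι → Ω) :=
  {w | ∀ i j, c (w i) = c (w j) ↔ q i = q j}

theorem mem_coincidenceSet {c : Ω → β} {q : ι → α} {w : ι → Ω} :
    w ∈ coincidenceSet c q ↔ ∀ i j, c (w i) = c (w j) ↔ q i = q j := Iff.rfl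

theorem coincidenceSet_inter_pi_eq_iUnion (c : Ω → β) {q : ι → α} (hq : Function.Surjective q)
    (A : α → Set Ω) :
    coincidenceSet c q ∩ (Set.univ.pi fun i => A (q i)) =
      ⋃ b : α ↪ β, Set.univ.pi fun i => A (q i) ∩ c ⁻¹' {b (q i)} := by
  ext w
  simp only [Set.mem_inter_iff, mem_coincidenceSet, Set.mem_univ_pi, Set.mem_iUnion,
    Set.mem_preimage, Set.mem_singleton_iff]
  constructor
  · rintro ⟨hw, hwA⟩
    have hs := Function.surjInv_eq hq
    refine ⟨⟨fun k => c (w (Function.surjInv hq k)), fun j k h => ?_⟩, fun i => ⟨hwA i, ?_⟩⟩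
    · simpa only [hs] using (hw _ _).1 h
    · exact (hw _ _).2 (hs _).symm
  · rintro ⟨b, hw⟩
    exact ⟨fun i j => by rw [(hw i).2, (hw j).2, b.injective.eq_iff], fun i => (hw i).1⟩

theorem pairwise_disjoint_pi_inter_preimage_singleton (c : Ω → β) {q : ι → α}
    (hq : Function.Surjective q) (A : α → Set Ω) :
    Pairwise (Function.onFun Disjoint fun b : α ↪ β =>
      Set.univ.pi fun i => A (q i) ∩ c ⁻¹' {b (q i)}) := by
  intro b b' hbb'
  refine Set.disjoint_left.2 fun w hw hw' => hbb' (DFunLike.ext _ _ fun k => ?_)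
  obtain ⟨i, rfl⟩ := hq k
  exact (hw i trivial).2.symm.trans (hw' i trivial).2

theorem eventually_mem_coincidenceSet_iff [Finite ι] {β : ℕ → Type*} {c : ∀ N, Ω → β N}
    (hsep : ∀ x y, ∀ᶠ N in atTop, (c N x = c N y ↔ x = y)) (q : ι → α) (w : ι → Ω) :
    ∀ᶠ N in atTop, (w ∈ coincidenceSet (c N) q ↔ w ∈ coincidenceSet id q) := by
  have h : ∀ᶠ N in atTop, ∀ i j, (c N (w i) = c N (w j) ↔ w i = w j) := by
    simpa only [eventually_all] using fun i j => hsep (w i) (w j)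
  filter_upwards [h] with N hN
  simp only [mem_coincidenceSet, hN, id_eq]

variable [MeasurableSpace Ω]

theorem exists_measurable_eventually_eq_iff (Ω : Type*) [MeasurableSpace Ω]
    [MeasurableSpace.CountablySeparated Ω] :
    ∃ c : ∀ N : ℕ, Ω → Fin N → Bool, (∀ N, Measurable (c N)) ∧
      ∀ x y, ∀ᶠ N in atTop, (c N x = c N y ↔ x = y) := by
  obtain ⟨f, hf, hinj⟩ := MeasurableSpace.measurable_injection_nat_bool_of_countablySeparated Ω
  refine ⟨fun N x i => f x i, fun N => by fun_prop, fun x y => ?_⟩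
  by_cases hxy : x = y
  · simp [hxy]
  · obtain ⟨n, hn⟩ := Function.ne_iff.1 (hinj.ne hxy)
    filter_upwards [eventually_gt_atTop n] with N hN
    exact iff_of_false (fun h => hn (congrFun h ⟨n, hN⟩)) hxy

theorem measurableEq_of_countablySeparated (Ω : Type*) [MeasurableSpace Ω]
    [MeasurableSpace.CountablySeparated Ω] : MeasurableEq Ω := by
  obtain ⟨c, hc, hsep⟩ := exists_measurable_eventually_eq_iff Ω
  exact ⟨measurableSet_of_tendsto_indicator atTop
    (fun N => measurableSet_eq_fun ((hc N).comp measurable_fst) ((hc N).comp measurable_snd))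
    fun p => hsep p.1 p.2⟩

theorem ae_injective_pi [MeasurableEq Ω] [Fintype ι] (μ : Measure Ω) [SigmaFinite μ]
    [NullSingletonClass μ] : ∀ᵐ v ∂Measure.pi fun _ : ι => μ, Function.Injective v := by
  classical
  have ae_ne (j k : ι) (hkj : k ≠ j) : ∀ᵐ v ∂Measure.pi fun _ : ι => μ, v k ≠ v j := by
    have he := measurePreserving_piEquivPiSubtypeProd (fun _ : ι => μ) (· ≠ j)
    have hs : MeasurableSet {p : ({i // i ≠ j} → Ω) × ({i // ¬i ≠ j} → Ω) |
        p.1 ⟨k, hkj⟩ = p.2 ⟨j, not_not.2 rfl⟩} := measurableSet_eq_fun (by fun_prop) (by fun_prop)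
    refine he.quasiMeasurePreserving.ae (measure_eq_zero_iff_ae_notMem.1
      ((Measure.measure_prod_null hs).2 (Eventually.of_forall fun v => ?_)))
    exact measure_mono_null (fun u hu => Eq.symm hu)
      (Measure.pi_hyperplane (fun _ : {i // ¬i ≠ j} => μ) ⟨j, not_not.2 rfl⟩ (v ⟨k, hkj⟩))
  have h : ∀ᵐ v ∂Measure.pi fun _ : ι => μ, ∀ j k, k ≠ j → v k ≠ v j := by
    simpa only [eventually_all] using ae_ne
  filter_upwards [h] with v hv k j hkj using by_contra fun hne => hv j k hne hkj

theorem measurableSet_coincidenceSet [Countable ι] [MeasurableSpace β] [MeasurableEq β]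
    {c : Ω → β} (hc : Measurable c) (q : ι → α) : MeasurableSet (coincidenceSet c q) := by
  simp only [coincidenceSet, Set.ofPred_forall]
  refine .iInter fun i => .iInter fun j => ?_
  have h : MeasurableSet {w : ι → Ω | c (w i) = c (w j)} := measurableSet_eq_fun
    (hc.comp (measurable_pi_apply i)) (hc.comp (measurable_pi_apply j))
  by_cases hij : q i = q j
  · simpa only [hij, iff_true] using h
  · simp only [hij, iff_false]
    exact h.compl

theorem measureReal_inter_preimage_singleton_tendsto_zero {β : ℕ → Type*}
    [∀ N, MeasurableSpace (β N)] [∀ N, MeasurableSingletonClass (β N)] {c : ∀ N, Ω → β N}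
    (hc : ∀ N, Measurable (c N)) (hsep : ∀ x y, ∀ᶠ N in atTop, (c N x = c N y ↔ x = y))
    (μ : Measure Ω) [IsFiniteMeasure μ] [NullSingletonClass μ] {A : Set Ω} (hA : MeasurableSet A)
    (x : Ω) : Tendsto (fun N => μ.real (A ∩ c N ⁻¹' {c N x})) atTop (𝓝 0) := by
  have h := tendsto_measure_of_tendsto_indicator_of_isFiniteMeasure (A := A ∩ {x}) atTop μ
    (fun N => hA.inter (hc N (measurableSet_singleton (c N x)))) fun y => by
      filter_upwards [hsep y x] with N hN
      simp [hN]
  rw [measure_mono_null Set.inter_subset_right (measure_singleton x)] at h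
  exact (ENNReal.tendsto_toReal ENNReal.zero_ne_top).comp h

section

variable [Finite ι] [Fintype α]

theorem measureReal_coincidenceSet_inter_pi [Finite β] [MeasurableSpace β]
    [MeasurableSingletonClass β] {c : Ω → β} (hc : Measurable c) (μ : Measure Ω)
    [IsFiniteMeasure μ] (M : Measure (ι → Ω)) [IsFiniteMeasure M] {q : ι → α}
    (hq : Function.Surjective q) (p : α → ℝ → ℝ) (K : ℝ)
    (hM : ∀ D : α → Set Ω, (∀ k, MeasurableSet (D k)) → Pairwise (Function.onFun Disjoint D) →
      M.real (Set.univ.pi fun i => D (q i)) = K * ∏ k, (μ.real (D k) * p k (μ.real (D k))))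
    {A : α → Set Ω} (hA : ∀ k, MeasurableSet (A k)) :
    M.real (coincidenceSet c q ∩ Set.univ.pi fun i => A (q i)) =
      K * ∫ v in coincidenceSet c (id : α → α) ∩ Set.univ.pi A,
        ∏ k, p k (μ.real (A k ∩ c ⁻¹' {c (v k)})) ∂Measure.pi fun _ => μ := by
  classical
  have := Fintype.ofFinite β
  have hD (b : α ↪ β) (k : α) : MeasurableSet (A k ∩ c ⁻¹' {b k}) :=
    (hA k).inter (hc (measurableSet_singleton _))
  have hval (b : α ↪ β) : Set.EqOn (fun v => ∏ k, p k (μ.real (A k ∩ c ⁻¹' {c (v k)})))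
      (fun _ => ∏ k, p k (μ.real (A k ∩ c ⁻¹' {b k})))
      (Set.univ.pi fun k => A k ∩ c ⁻¹' {b k}) := fun v hv =>
    Finset.prod_congr rfl fun k _ => by rw [(hv k trivial).2]
  have hint (b : α ↪ β) : ∫ v in Set.univ.pi fun k => A k ∩ c ⁻¹' {b k},
      ∏ k, p k (μ.real (A k ∩ c ⁻¹' {c (v k)})) ∂Measure.pi (fun _ => μ) =
        ∏ k, (μ.real (A k ∩ c ⁻¹' {b k}) * p k (μ.real (A k ∩ c ⁻¹' {b k}))) := by
    rw [setIntegral_congr_fun (.univ_pi (hD b)) (hval b), setIntegral_const, smul_eq_mul,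
      Finset.prod_mul_distrib, measureReal_def, Measure.pi_pi, ENNReal.toReal_prod]
    rfl
  have hU := coincidenceSet_inter_pi_eq_iUnion c Function.surjective_id A
  have hdisj := pairwise_disjoint_pi_inter_preimage_singleton c Function.surjective_id A
  simp only [id_eq] at hU hdisj
  rw [coincidenceSet_inter_pi_eq_iUnion c hq, measureReal_iUnion_fintype
    (pairwise_disjoint_pi_inter_preimage_singleton c hq A) fun b => .univ_pi fun i => hD b (q i),
    hU, integral_iUnion_fintype (fun b => .univ_pi (hD b)) hdisj fun b =>
      (integrableOn_congr_fun (hval b) (.univ_pi (hD b))).2 (integrable_const _).integrableOn,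
    Finset.mul_sum]
  refine Finset.sum_congr rfl fun b _ => ?_
  rw [hint b, hM _ (hD b)]
  exact fun j k hjk => Set.disjoint_left.2 fun x hx hx' =>
    hjk (b.injective (hx.2.symm.trans hx'.2))

variable [MeasurableSpace.CountablySeparated Ω]

theorem tendsto_setIntegral_coincidenceSet_inter_pi {β : ℕ → Type*} [∀ N, Finite (β N)]
    [∀ N, MeasurableSpace (β N)] [∀ N, MeasurableSingletonClass (β N)] {c : ∀ N, Ω → β N}
    (hc : ∀ N, Measurable (c N)) (hsep : ∀ x y, ∀ᶠ N in atTop, (c N x = c N y ↔ x = y))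
    (μ : Measure Ω) [IsFiniteMeasure μ] [NullSingletonClass μ] {p : α → ℝ → ℝ}
    (hp : ∀ k, Continuous (p k)) {A : α → Set Ω} (hA : ∀ k, MeasurableSet (A k)) :
    Tendsto (fun N => ∫ v in coincidenceSet (c N) (id : α → α) ∩ Set.univ.pi A,
        ∏ k, p k (μ.real (A k ∩ c N ⁻¹' {c N (v k)})) ∂Measure.pi fun _ => μ) atTop
      (𝓝 (∏ k, (μ.real (A k) * p k 0))) := by
  have := measurableEq_of_countablySeparated Ω
  have hcoin (N : ℕ) : MeasurableSet (coincidenceSet (c N) (id : α → α)) :=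
    measurableSet_coincidenceSet (hc N) id
  have hval : ∏ k, (μ.real (A k) * p k 0) =
      ∫ _ in Set.univ.pi A, ∏ k, p k 0 ∂Measure.pi fun _ => μ := by
    rw [setIntegral_const, smul_eq_mul, Finset.prod_mul_distrib, measureReal_def, Measure.pi_pi,
      ENNReal.toReal_prod]
    rfl
  have hbound (k : α) : ∃ B, ∀ t ∈ Set.Icc 0 (μ.real Set.univ), ‖p k t‖ ≤ B :=
    isCompact_Icc.exists_bound_of_continuousOn (hp k).continuousOn
  choose B hB using hbound
  simp only [Set.inter_comm _ (Set.univ.pi A), ← setIntegral_indicator (hcoin _), hval]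
  refine tendsto_integral_of_dominated_convergence (fun _ => ∏ k, B k) (fun N => ?_)
    (integrable_const _) (fun N => Eventually.of_forall fun v => ?_) ?_
  · refine (Measurable.indicator (Finset.measurable_prod _ fun k _ => ?_)
      (hcoin N)).aestronglyMeasurable
    exact (measurable_of_finite fun b => p k (μ.real (A k ∩ c N ⁻¹' {b}))).comp
      ((hc N).comp (measurable_pi_apply k))
  · refine (norm_indicator_le_norm_self _ _).trans ?_
    rw [norm_prod]
    exact Finset.prod_le_prod (fun _ _ => norm_nonneg _) fun k _ =>
      hB k _ ⟨measureReal_nonneg, measureReal_mono (Set.subset_univ _)⟩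
  · refine ae_restrict_of_ae ?_
    filter_upwards [ae_injective_pi μ] with v hv
    have hmem : ∀ᶠ N in atTop, v ∈ coincidenceSet (c N) (id : α → α) := by
      filter_upwards [eventually_mem_coincidenceSet_iff hsep id v] with N hN
      exact hN.2 fun j k => hv.eq_iff
    refine Tendsto.congr' (hmem.mono fun N hN => (Set.indicator_of_mem hN _).symm)
      (tendsto_finsetProd _ fun k _ => ((hp k).tendsto 0).comp ?_)
    exact measureReal_inter_preimage_singleton_tendsto_zero hc hsep μ (hA k) (v k)

theorem measureReal_coincidenceSet_id_inter_pi (μ : Measure Ω) [IsFiniteMeasure μ]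
    [NullSingletonClass μ] (M : Measure (ι → Ω)) [IsFiniteMeasure M] {q : ι → α}
    (hq : Function.Surjective q) {p : α → ℝ → ℝ} (hp : ∀ k, Continuous (p k)) {K : ℝ}
    (hM : ∀ D : α → Set Ω, (∀ k, MeasurableSet (D k)) → Pairwise (Function.onFun Disjoint D) →
      M.real (Set.univ.pi fun i => D (q i)) = K * ∏ k, (μ.real (D k) * p k (μ.real (D k))))
    {A : α → Set Ω} (hA : ∀ k, MeasurableSet (A k)) :
    M.real (coincidenceSet id q ∩ Set.univ.pi fun i => A (q i)) =
      K * ∏ k, (μ.real (A k) * p k 0) := by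
  obtain ⟨c, hc, hsep⟩ := exists_measurable_eventually_eq_iff Ω
  have hlim := tendsto_measure_of_tendsto_indicator_of_isFiniteMeasure atTop M
    (A := coincidenceSet id q ∩ Set.univ.pi fun i => A (q i))
    (fun N => (measurableSet_coincidenceSet (hc N) q).inter (.univ_pi fun i => hA (q i)))
    fun w => (eventually_mem_coincidenceSet_iff hsep q w).mono fun N hN => and_congr_left' hN
  refine tendsto_nhds_unique ((ENNReal.tendsto_toReal (measure_ne_top _ _)).comp hlim) ?_
  exact ((tendsto_setIntegral_coincidenceSet_inter_pi hc hsep μ hp hA).const_mul K).congr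
    fun N => (measureReal_coincidenceSet_inter_pi (hc N) μ M hq p K hM hA).symm

theorem map_restrict_coincidenceSet (μ : Measure Ω) [IsFiniteMeasure μ] [NullSingletonClass μ]
    (M : Measure (ι → Ω)) [IsFiniteMeasure M] {q : ι → α} {σ : α → ι} (hσ : ∀ k, q (σ k) = k)
    {p : α → ℝ → ℝ} (hp : ∀ k, Continuous (p k)) {K : ℝ}
    (hM : ∀ D : α → Set Ω, (∀ k, MeasurableSet (D k)) → Pairwise (Function.onFun Disjoint D) →
      M.real (Set.univ.pi fun i => D (q i)) = K * ∏ k, (μ.real (D k) * p k (μ.real (D k)))) :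
    (M.restrict (coincidenceSet id q)).map (fun w k => w (σ k)) =
      ENNReal.ofReal (K * ∏ k, p k 0) • Measure.pi fun _ => μ := by
  have hmeas : Measurable fun (w : ι → Ω) k => w (σ k) := by fun_prop
  refine ext_univ_pi fun A hA => ?_
  have hpre : (fun (w : ι → Ω) k => w (σ k)) ⁻¹' Set.univ.pi A ∩ coincidenceSet id q =
      coincidenceSet id q ∩ Set.univ.pi fun i => A (q i) := by
    rw [Set.inter_comm]
    ext w
    refine and_congr_right fun hw => ⟨fun h i _ => ?_, fun h k _ => ?_⟩
    · rw [show w i = w (σ (q i)) from (hw i _).2 (hσ (q i)).symm]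
      exact h (q i) trivial
    · simpa only [hσ] using h (σ k) trivial
  rw [Measure.map_apply hmeas (.univ_pi hA), Measure.restrict_apply (hmeas (.univ_pi hA)), hpre,
    ← ofReal_measureReal, measureReal_coincidenceSet_id_inter_pi μ M (fun k => ⟨σ k, hσ k⟩) hp hM
    hA, Measure.smul_apply, Measure.pi_pi, smul_eq_mul, Finset.prod_mul_distrib,
    mul_left_comm, mul_comm, ENNReal.ofReal_mul'
    (Finset.prod_nonneg fun _ _ => measureReal_nonneg),
    ENNReal.ofReal_prod_of_nonneg fun _ _ => measureReal_nonneg]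
  simp only [ofReal_measureReal, ne_eq, measure_ne_top, not_false_eq_true]

end

end Coincidence

/-! ### The base distribution -/

section BaseLaw

variable {Ω : Type*} [MeasurableSpace Ω] (G₀ : Measure Ω)

instance [IsFiniteMeasure G₀] [NeZero G₀] : IsProbabilityMeasure (baseLaw G₀) := by
  unfold baseLaw
  infer_instance

instance [NullSingletonClass G₀] : NullSingletonClass (baseLaw G₀) :=
  ⟨fun x => by simp [baseLaw]⟩

theorem measureReal_eq_mul_baseLaw [IsFiniteMeasure G₀] [NeZero G₀] (A : Set Ω) :
    G₀.real A = G₀.real Set.univ * (baseLaw G₀).real A := by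
  rw [baseLaw, measureReal_ennreal_smul_apply, ENNReal.toReal_inv, ← measureReal_def,
    mul_inv_cancel_left₀ (measureReal_univ_ne_zero)]

end BaseLaw

/-! ### The Laplace exponent of a Lévy measure -/

section LaplaceExponent

theorem norm_cexp_mul_le_one {w : ℂ} (hw : w.re ≤ 0) {x : ℝ} (hx : 0 ≤ x) :
    ‖Complex.exp (w * x)‖ ≤ 1 := by
  rw [Complex.norm_exp, Complex.re_mul_ofReal]
  exact Real.exp_le_one_iff.2 (mul_nonpos_of_nonpos_of_nonneg hw hx)

theorem norm_cexp_sub_one_le {z : ℂ} (hz : z.re ≤ 0) :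
    ‖Complex.exp z - 1‖ ≤ 2 * min 1 ‖z‖ := by
  rcases le_total ‖z‖ 1 with h | h
  · rw [min_eq_right h]
    exact Complex.norm_exp_sub_one_le h
  · rw [min_eq_left h]
    calc ‖Complex.exp z - 1‖ ≤ Real.exp z.re + 1 := by
          simpa [Complex.norm_exp] using norm_sub_le (Complex.exp z) 1
      _ ≤ 2 * 1 := by linarith [Real.exp_le_one_iff.2 hz]

theorem norm_cexp_mul_sub_one_le {w : ℂ} (hw : w.re ≤ 0) {r C : ℝ} (hr : 0 < r) (hC : 1 ≤ C)
    (hwC : ‖w‖ ≤ C) : ‖Complex.exp (w * r) - 1‖ ≤ 2 * C * min 1 r := by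
  have hre : (w * r).re ≤ 0 := by
    simpa using mul_nonpos_of_nonpos_of_nonneg hw hr.le
  refine (norm_cexp_sub_one_le hre).trans ?_
  rw [mul_assoc, mul_min_of_nonneg _ _ (by linarith : 0 ≤ C), mul_one, norm_mul,
    Complex.norm_real, Real.norm_of_nonneg hr.le]
  gcongr

theorem mul_exp_neg_mul_le {δ : ℝ} (hδ : 0 < δ) {r : ℝ} (hr : 0 < r) :
    r * Real.exp (-δ * r) ≤ (1 + δ⁻¹) * min 1 r := by
  have hδ' : 0 < δ⁻¹ := inv_pos.2 hδ
  rcases le_total r 1 with h | h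
  · rw [min_eq_right h]
    have : Real.exp (-δ * r) ≤ 1 := Real.exp_le_one_iff.2 (by nlinarith)
    nlinarith
  · rw [min_eq_left h, neg_mul, Real.exp_neg, ← div_eq_mul_inv, div_le_iff₀ (Real.exp_pos _)]
    have hexp : δ * r ≤ Real.exp (δ * r) := by linarith [Real.add_one_le_exp (δ * r)]
    calc r = δ⁻¹ * (δ * r) := by field_simp
      _ ≤ δ⁻¹ * Real.exp (δ * r) := by gcongr
      _ ≤ (1 + δ⁻¹) * 1 * Real.exp (δ * r) := by
          rw [mul_one]
          gcongr
          linarith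

/-- The Laplace exponent `∫ (e^{wr} - 1) ρ(dr)` of a Lévy measure `ρ`, for complex `w` in the left
half-plane. -/
def levyExponent (ρ : Measure ℝ) (w : ℂ) : ℂ := ∫ r : ℝ, (Complex.exp (w * r) - 1) ∂ρ

theorem levyExponent_ofReal (ρ : Measure ℝ) (t : ℝ) :
    levyExponent ρ t = ((∫ r, (Real.exp (t * r) - 1) ∂ρ : ℝ) : ℂ) := by
  rw [levyExponent, ← integral_complex_ofReal]
  simp

namespace IsLevyMeasure

variable {ρ : Measure ℝ}

theorem ae_pos (hρ : IsLevyMeasure ρ) : ∀ᵐ r ∂ρ, 0 < r := by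
  rw [ae_iff]
  simpa [Set.Iic] using hρ.nonpos_null

theorem integrable_min (hρ : IsLevyMeasure ρ) : Integrable (fun r => min 1 r) ρ := by
  refine ⟨by fun_prop, ?_⟩
  rw [hasFiniteIntegral_iff_ofReal]
  · exact hρ.lintegral_min_lt_top
  · filter_upwards [hρ.ae_pos] with r hr using le_min zero_le_one hr.le

theorem integrable_of_le (hρ : IsLevyMeasure ρ) {E : Type*} [NormedAddCommGroup E] {g : ℝ → E}
    (hg : AEStronglyMeasurable g ρ) (C : ℝ) (h : ∀ r, 0 < r → ‖g r‖ ≤ C * min 1 r) :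
    Integrable g ρ := by
  refine (hρ.integrable_min.const_mul C).mono' hg ?_
  filter_upwards [hρ.ae_pos] with r hr using h r hr

theorem integrable_cexp_sub_one (hρ : IsLevyMeasure ρ) {w : ℂ} (hw : w.re ≤ 0) :
    Integrable (fun r : ℝ => Complex.exp (w * r) - 1) ρ :=
  hρ.integrable_of_le (by fun_prop) (2 * (1 + ‖w‖)) fun _ hr =>
    norm_cexp_mul_sub_one_le hw hr (by simp) (by simp)

theorem integrable_mul_exp (hρ : IsLevyMeasure ρ) {δ : ℝ} (hδ : 0 < δ) :
    Integrable (fun r : ℝ => r * Real.exp (-δ * r)) ρ := by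
  refine hρ.integrable_of_le (by fun_prop) (1 + δ⁻¹) fun r hr => ?_
  rw [Real.norm_of_nonneg (by positivity)]
  exact mul_exp_neg_mul_le hδ hr

theorem hasDerivAt_levyExponent (hρ : IsLevyMeasure ρ) {w : ℂ} (hw : w.re < 0) :
    HasDerivAt (levyExponent ρ) (∫ r : ℝ, r * Complex.exp (w * r) ∂ρ) w := by
  have hδ : 0 < -(w.re / 2) := by linarith
  have hs : {z : ℂ | z.re < w.re / 2} ∈ 𝓝 w :=
    (isOpen_lt Complex.continuous_re continuous_const).mem_nhds
      (show w.re < w.re / 2 by linarith)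
  refine (hasDerivAt_integral_of_dominated_loc_of_deriv_le
    (F' := fun z (r : ℝ) => (r : ℂ) * Complex.exp (z * r))
    (bound := fun r => r * Real.exp (-(-(w.re / 2)) * r)) hs
    (Eventually.of_forall fun z => by fun_prop) (hρ.integrable_cexp_sub_one hw.le) (by fun_prop)
    ?_ (hρ.integrable_mul_exp hδ) ?_).2
  · filter_upwards [hρ.ae_pos] with r hr z (hz : z.re < w.re / 2)
    rw [norm_mul, Complex.norm_real, Real.norm_of_nonneg hr.le, Complex.norm_exp, neg_neg,
      Complex.re_mul_ofReal]
    gcongr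
  · refine Eventually.of_forall fun r z _ => ?_
    simpa [mul_comm] using ((hasDerivAt_id z).mul_const (r : ℂ)).cexp.sub_const 1

theorem continuousOn_levyExponent (hρ : IsLevyMeasure ρ) :
    ContinuousOn (levyExponent ρ) {w | w.re ≤ 0} := by
  intro w _
  have hnear : ∀ᶠ z in 𝓝[{w : ℂ | w.re ≤ 0}] w, ‖z‖ ≤ ‖w‖ + 1 :=
    (continuous_norm.tendsto w).mono_left nhdsWithin_le_nhds
      |>.eventually (eventually_le_nhds (by linarith))
  refine continuousWithinAt_of_dominated (bound := fun r => 2 * (‖w‖ + 1) * min 1 r)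
    (Eventually.of_forall fun z => by fun_prop) ?_ (hρ.integrable_min.const_mul _)
    (Eventually.of_forall fun r => Continuous.continuousWithinAt (by fun_prop))
  filter_upwards [hnear, self_mem_nhdsWithin] with z hz hz'
  filter_upwards [hρ.ae_pos] with r hr
  exact norm_cexp_mul_sub_one_le hz' hr (by simp) hz

theorem re_levyExponent_nonpos (hρ : IsLevyMeasure ρ) {w : ℂ} (hw : w.re ≤ 0) :
    (levyExponent ρ w).re ≤ 0 := by
  rw [levyExponent, ← RCLike.re_eq_complex_re, ← integral_re (hρ.integrable_cexp_sub_one hw)]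
  refine integral_nonpos_of_ae ?_
  filter_upwards [hρ.ae_pos] with r hr
  have hre := (Complex.re_le_norm _).trans (norm_cexp_mul_le_one hw hr.le)
  simpa using hre

theorem diffContOnCl_exp_mul_levyExponent (hρ : IsLevyMeasure ρ) (a : ℂ) :
    DiffContOnCl ℂ (fun w => Complex.exp (a * levyExponent ρ w)) {w | w.re < 0} := by
  refine ⟨fun w hw => ?_, ?_⟩
  · exact ((hρ.hasDerivAt_levyExponent hw).const_mul a).cexp.differentiableAt.differentiableWithinAt
  · rw [Complex.closure_setOfPred_re_lt]
    exact (hρ.continuousOn_levyExponent.const_smul a).cexp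

theorem norm_exp_mul_levyExponent_le_one (hρ : IsLevyMeasure ρ) {a : ℝ} (ha : 0 ≤ a) {w : ℂ}
    (hw : w.re ≤ 0) : ‖Complex.exp (a * levyExponent ρ w)‖ ≤ 1 := by
  rw [Complex.norm_exp, Complex.re_ofReal_mul]
  exact Real.exp_le_one_iff.2 (mul_nonpos_of_nonneg_of_nonpos ha (hρ.re_levyExponent_nonpos hw))

end IsLevyMeasure

end LaplaceExponent

/-! ### From the characteristic function to the Laplace transform -/

section LaplaceTransform

theorem eqOn_left_half_plane_of_bounded {E : Type*} [NormedAddCommGroup E] [NormedSpace ℂ E]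
    {f g : ℂ → E} (hf : DiffContOnCl ℂ f {w | w.re < 0}) (hg : DiffContOnCl ℂ g {w | w.re < 0})
    {C D : ℝ} (hfC : ∀ w : ℂ, w.re ≤ 0 → ‖f w‖ ≤ C) (hgD : ∀ w : ℂ, w.re ≤ 0 → ‖g w‖ ≤ D)
    (h : ∀ u : ℝ, f (Complex.I * u) = g (Complex.I * u)) :
    Set.EqOn f g {w | w.re ≤ 0} := by
  set d : ℂ → E := fun w => f (-w) - g (-w) with hd
  have hbound : ∀ w : ℂ, 0 ≤ w.re → ‖d w‖ ≤ C + D := fun w hw =>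
    (norm_sub_le _ _).trans (add_le_add (hfC _ (by simpa using hw)) (hgD _ (by simpa using hw)))
  have hdiff : DiffContOnCl ℂ d {w | 0 < w.re} :=
    (hf.sub hg).comp differentiable_neg.diffContOnCl fun w hw => by
      simpa using hw
  have himag : ∀ x : ℝ, ‖d (x * Complex.I)‖ ≤ 0 := fun x => by
    have heq := h (-x)
    rw [Complex.ofReal_neg, mul_neg, mul_comm Complex.I] at heq
    simp [hd, heq]
  intro w hw
  have hzero : ‖d (-w)‖ ≤ 0 := by
    refine PhragmenLindelof.right_half_plane_of_bounded_on_real hdiff ⟨1, one_lt_two, 0, ?_⟩ ?_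
      himag (by simpa using hw)
    · refine Asymptotics.IsBigO.of_bound (C + D) (eventually_inf_principal.2 ?_)
      exact Eventually.of_forall fun z hz => by simpa using hbound z (le_of_lt hz)
    · refine ⟨C + D, eventually_map.2 ?_⟩
      filter_upwards [eventually_ge_atTop 0] with x hx using hbound x (by simpa using hx)
  simpa [hd, sub_eq_zero] using hzero

variable {S : Type*} [MeasurableSpace S] {P : Measure S} {X : S → ℝ}

theorem integrable_exp_mul_of_nonpos [IsFiniteMeasure P] (hX : AEMeasurable X P)
    (hX0 : 0 ≤ᵐ[P] X) {t : ℝ} (ht : t ≤ 0) : Integrable (fun s => Real.exp (t * X s)) P := by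
  refine Integrable.of_bound (C := 1) (by fun_prop) ?_
  filter_upwards [hX0] with s hs
  rw [Real.norm_of_nonneg (Real.exp_pos _).le]
  exact Real.exp_le_one_iff.2 (mul_nonpos_of_nonpos_of_nonneg ht hs)

theorem mem_interior_integrableExpSet
    (h : ∀ t < 0, Integrable (fun s => Real.exp (t * X s)) P) {t : ℝ} (ht : t < 0) :
    t ∈ interior (integrableExpSet X P) :=
  interior_maximal (fun u hu => h u hu) isOpen_Iio ht

theorem norm_complexMGF_le_one [IsProbabilityMeasure P] (hX0 : 0 ≤ᵐ[P] X) {w : ℂ} (hw : w.re ≤ 0) :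
    ‖complexMGF X P w‖ ≤ 1 := by
  refine (norm_integral_le_of_norm_le_const (C := 1) ?_).trans_eq (by simp)
  filter_upwards [hX0] with s hs using norm_cexp_mul_le_one hw hs

theorem diffContOnCl_complexMGF [IsFiniteMeasure P] (hX : AEMeasurable X P) (hX0 : 0 ≤ᵐ[P] X) :
    DiffContOnCl ℂ (complexMGF X P) {w | w.re < 0} := by
  refine ⟨fun w hw => ?_, ?_⟩
  · exact (hasDerivAt_complexMGF (mem_interior_integrableExpSet
      (fun t ht => integrable_exp_mul_of_nonpos hX hX0 ht.le) hw)).differentiableAt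
      |>.differentiableWithinAt
  · rw [Complex.closure_setOfPred_re_lt]
    refine fun w _ => continuousWithinAt_of_dominated (bound := fun _ => 1)
      (Eventually.of_forall fun z => by fun_prop) ?_ (integrable_const _)
      (Eventually.of_forall fun s => Continuous.continuousWithinAt (by fun_prop))
    filter_upwards [self_mem_nhdsWithin] with z hz
    filter_upwards [hX0] with s hs using norm_cexp_mul_le_one hz hs

theorem mgf_eq_exp_of_characteristic [IsProbabilityMeasure P] (hX : AEMeasurable X P)
    (hX0 : 0 ≤ᵐ[P] X) {ρ : Measure ℝ} (hρ : IsLevyMeasure ρ) {a : ℝ} (ha : 0 ≤ a)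
    (h : ∀ u : ℝ, ∫ s, Complex.exp (Complex.I * u * X s) ∂P =
      Complex.exp (a * levyExponent ρ (Complex.I * u))) {t : ℝ} (ht : t ≤ 0) :
    mgf X P t = Real.exp (a * ∫ r, (Real.exp (t * r) - 1) ∂ρ) := by
  have heq := eqOn_left_half_plane_of_bounded (diffContOnCl_complexMGF hX hX0)
    (hρ.diffContOnCl_exp_mul_levyExponent a) (fun _ => norm_complexMGF_le_one hX0)
    (fun _ => hρ.norm_exp_mul_levyExponent_le_one ha) h (show (t : ℂ).re ≤ 0 by simpa using ht)
  simp only [levyExponent_ofReal, complexMGF_ofReal] at heq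
  exact_mod_cast heq

end LaplaceTransform

/-! ### Bell polynomials -/

section BellPolynomial

open Polynomial

/-- The complete Bell polynomial `Bₙ(a c₁, a c₂, …)` as a polynomial in `a`, through the recursion
`Bₙ₊₁ = a ∑ᵢ (n choose i) cₙ₋ᵢ₊₁ Bᵢ`. For `cₖ = ψ⁽ᵏ⁾(x)` it is the ratio of the `n`-th derivative of
`e^{aψ}` at `x` to `e^{aψ(x)}`. -/
def bellPolynomial {R : Type*} [CommSemiring R] (c : ℕ → R) : ℕ → R[X]
  | 0 => 1
  | n + 1 => X * ∑ i : Fin (n + 1), C (n.choose i * c (n - i + 1)) * bellPolynomial c i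

theorem bellPolynomial_zero {R : Type*} [CommSemiring R] (c : ℕ → R) :
    bellPolynomial c 0 = 1 := by
  rw [bellPolynomial]

theorem bellPolynomial_succ {R : Type*} [CommSemiring R] (c : ℕ → R) (n : ℕ) :
    bellPolynomial c (n + 1) =
      X * ∑ i : Fin (n + 1), C (n.choose i * c (n - i + 1)) * bellPolynomial c i := by
  rw [bellPolynomial]

theorem coeff_zero_bellPolynomial {R : Type*} [CommSemiring R] (c : ℕ → R) {n : ℕ} (hn : n ≠ 0) :
    (bellPolynomial c n).coeff 0 = 0 := by
  obtain ⟨n, rfl⟩ := Nat.exists_eq_succ_of_ne_zero hn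
  rw [Nat.succ_eq_add_one, bellPolynomial_succ, coeff_X_mul_zero]

theorem coeff_one_bellPolynomial {R : Type*} [CommSemiring R] (c : ℕ → R) {n : ℕ} (hn : n ≠ 0) :
    (bellPolynomial c n).coeff 1 = c n := by
  obtain ⟨n, rfl⟩ := Nat.exists_eq_succ_of_ne_zero hn
  rw [Nat.succ_eq_add_one, bellPolynomial_succ, coeff_X_mul, finsetSum_coeff,
    Finset.sum_eq_single (0 : Fin (n + 1))]
  · simp [bellPolynomial_zero]
  · intro i _ hi
    rw [coeff_C_mul, coeff_zero_bellPolynomial c (Fin.val_ne_zero_iff.2 hi), mul_zero]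
  · simp

theorem eval_bellPolynomial_eq_mul_divX {R : Type*} [CommSemiring R] (c : ℕ → R) {n : ℕ}
    (hn : n ≠ 0) (a : R) :
    (bellPolynomial c n).eval a = a * (bellPolynomial c n).divX.eval a := by
  conv_lhs => rw [← divX_mul_X_add (bellPolynomial c n), coeff_zero_bellPolynomial c hn]
  simp [mul_comm]

theorem eval_zero_divX_bellPolynomial {R : Type*} [CommSemiring R] (c : ℕ → R) {n : ℕ}
    (hn : n ≠ 0) : (bellPolynomial c n).divX.eval 0 = c n := by
  rw [← coeff_zero_eq_eval_zero, coeff_divX, coeff_one_bellPolynomial c hn]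

theorem iteratedDeriv_exp_mul {ψ : ℝ → ℝ} {x : ℝ} (hψ : AnalyticAt ℝ ψ x) {c : ℕ → ℝ}
    (hc : ∀ k, iteratedDeriv (k + 1) ψ x = c (k + 1)) (a : ℝ) (n : ℕ) :
    iteratedDeriv n (fun t => Real.exp (a * ψ t)) x =
      (bellPolynomial c n).eval a * Real.exp (a * ψ x) := by
  set φ : ℝ → ℝ := fun t => Real.exp (a * ψ t)
  have hφ : AnalyticAt ℝ φ x := (analyticAt_const.mul hψ).rexp'
  have hderiv : deriv φ =ᶠ[𝓝 x] fun t => a * (φ t * deriv ψ t) := by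
    filter_upwards [hψ.eventually_analyticAt] with t ht
    rw [((ht.differentiableAt.hasDerivAt.const_mul a).exp).deriv]
    ring
  induction n using Nat.strong_induction_on with
  | _ n ih =>
    cases n with
    | zero => simp [bellPolynomial_zero, φ]
    | succ n =>
      rw [iteratedDeriv_succ', (hderiv.iteratedDeriv n).eq_of_nhds, iteratedDeriv_const_mul_field,
        iteratedDeriv_fun_mul hφ.contDiffAt hψ.deriv.contDiffAt, bellPolynomial_succ,
        ← Fin.sum_univ_eq_sum_range (fun i => (n.choose i : ℝ) * iteratedDeriv i φ x *
            iteratedDeriv (n - i) (deriv ψ) x), eval_mul, eval_X, eval_finsetSum, mul_assoc,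
        Finset.sum_mul]
      congr! 2 with i
      rw [ih i i.2, ← iteratedDeriv_succ', hc, eval_mul, eval_C]
      ring

end BellPolynomial

/-! ### Exponentially tilted moments -/

section TiltedMoments

/-- The moment `∫ rⁿ e^{tr} ρ(dr)` of the exponentially tilted measure `e^{tr} ρ(dr)`. -/
def tiltedMoment (ρ : Measure ℝ) (t : ℝ) (n : ℕ) : ℝ := ∫ r, r ^ n * Real.exp (t * r) ∂ρ

/-- The measure `r ρ(dr)`, which turns the derivative of the Laplace exponent of `ρ` into a
moment generating function. -/
def sizeBiased (ρ : Measure ℝ) : Measure ℝ := ρ.withDensity fun r => ENNReal.ofReal r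

namespace IsLevyMeasure

variable {ρ : Measure ℝ}

theorem integrable_exp_sizeBiased (hρ : IsLevyMeasure ρ) {t : ℝ} (ht : t < 0) :
    Integrable (fun r => Real.exp (t * id r)) (sizeBiased ρ) := by
  rw [sizeBiased, integrable_withDensity_iff_integrable_smul' (by fun_prop) (by simp)]
  refine (hρ.integrable_mul_exp (neg_pos.2 ht)).congr ?_
  filter_upwards [hρ.ae_pos] with r hr
  simp [ENNReal.toReal_ofReal hr.le]

theorem tiltedMoment_sizeBiased (hρ : IsLevyMeasure ρ) (t : ℝ) (n : ℕ) :
    tiltedMoment (sizeBiased ρ) t n = tiltedMoment ρ t (n + 1) := by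
  rw [tiltedMoment, sizeBiased,
    integral_withDensity_eq_integral_toReal_smul (by fun_prop) (by simp)]
  refine integral_congr_ae ?_
  filter_upwards [hρ.ae_pos] with r hr
  rw [ENNReal.toReal_ofReal hr.le, smul_eq_mul]
  ring

theorem analyticAt_integral_exp_sub_one (hρ : IsLevyMeasure ρ) {t : ℝ} (ht : t < 0) :
    AnalyticAt ℝ (fun t => ∫ r, (Real.exp (t * r) - 1) ∂ρ) t := by
  have hdiff : DifferentiableOn ℂ (levyExponent ρ) {w | w.re < 0} := fun w hw =>
    (hρ.hasDerivAt_levyExponent hw).differentiableAt.differentiableWithinAt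
  have hmem : {w : ℂ | w.re < 0} ∈ 𝓝 (t : ℂ) :=
    (isOpen_lt Complex.continuous_re continuous_const).mem_nhds (by simpa using ht)
  simpa only [levyExponent_ofReal, Complex.ofReal_re] using (hdiff.analyticAt hmem).re_ofReal

theorem hasDerivAt_integral_exp_sub_one (hρ : IsLevyMeasure ρ) {t : ℝ} (ht : t < 0) :
    HasDerivAt (fun t => ∫ r, (Real.exp (t * r) - 1) ∂ρ) (tiltedMoment ρ t 1) t := by
  have hreal : (∫ r : ℝ, (r : ℂ) * Complex.exp (t * r) ∂ρ) = (tiltedMoment ρ t 1 : ℂ) := by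
    rw [tiltedMoment, ← integral_complex_ofReal]
    simp
  have h := (hρ.hasDerivAt_levyExponent (w := t) (by simpa using ht)).real_of_complex
  simpa only [levyExponent_ofReal, Complex.ofReal_re, hreal] using h

theorem iteratedDeriv_integral_exp_sub_one (hρ : IsLevyMeasure ρ) {t : ℝ} (ht : t < 0) (k : ℕ) :
    iteratedDeriv (k + 1) (fun t => ∫ r, (Real.exp (t * r) - 1) ∂ρ) t =
      tiltedMoment ρ t (k + 1) := by
  have hderiv : deriv (fun t => ∫ r, (Real.exp (t * r) - 1) ∂ρ) =ᶠ[𝓝 t]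
      mgf id (sizeBiased ρ) := by
    filter_upwards [Iio_mem_nhds ht] with u hu
    rw [(hρ.hasDerivAt_integral_exp_sub_one hu).deriv, ← hρ.tiltedMoment_sizeBiased, tiltedMoment]
    simp [mgf]
  rw [iteratedDeriv_succ', (hderiv.iteratedDeriv k).eq_of_nhds, iteratedDeriv_mgf
    (mem_interior_integrableExpSet (fun _ => hρ.integrable_exp_sizeBiased) ht),
    ← hρ.tiltedMoment_sizeBiased]
  rfl

end IsLevyMeasure

theorem integral_pow_mul_exp {S : Type*} [MeasurableSpace S] {P : Measure S}
    {X : S → ℝ} {ρ : Measure ℝ} (hρ : IsLevyMeasure ρ) {a : ℝ}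
    (hint : ∀ t < 0, Integrable (fun s => Real.exp (t * X s)) P)
    (h : ∀ t < 0, mgf X P t = Real.exp (a * ∫ r, (Real.exp (t * r) - 1) ∂ρ)) {t : ℝ} (ht : t < 0)
    (n : ℕ) :
    ∫ s, X s ^ n * Real.exp (t * X s) ∂P =
      (bellPolynomial (tiltedMoment ρ t) n).eval a *
        Real.exp (a * ∫ r, (Real.exp (t * r) - 1) ∂ρ) := by
  have hmgf : mgf X P =ᶠ[𝓝 t] fun t => Real.exp (a * ∫ r, (Real.exp (t * r) - 1) ∂ρ) := by
    filter_upwards [Iio_mem_nhds ht] with u hu using h u hu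
  rw [← iteratedDeriv_mgf (mem_interior_integrableExpSet hint ht),
    (hmgf.iteratedDeriv n).eq_of_nhds]
  exact iteratedDeriv_exp_mul (hρ.analyticAt_integral_exp_sub_one ht)
    (hρ.iteratedDeriv_integral_exp_sub_one ht) a n

end TiltedMoments

/-! ### Tilted moments of completely random measures -/

theorem sizePMF_eq_eval_bellPolynomial {ρ : Measure ℝ} (hρ : IsLevyMeasure ρ) (γ₀ : ℝ) (n : ℕ) :
    sizePMF γ₀ ρ n = (bellPolynomial (tiltedMoment ρ (-1)) n).eval γ₀ *
      Real.exp (γ₀ * ∫ r, (Real.exp (-r) - 1) ∂ρ) / n.factorial := by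
  let φ : ℝ → ℝ := fun u => Real.exp (γ₀ * ∫ r, (Real.exp (u * r) - 1) ∂ρ)
  have hpgf : sizePGF γ₀ ρ = fun t => φ (t - 1) := by
    funext t
    simp only [φ, sizePGF, neg_sub]
  have hderiv := iteratedDeriv_exp_mul (hρ.analyticAt_integral_exp_sub_one neg_one_lt_zero)
    (hρ.iteratedDeriv_integral_exp_sub_one neg_one_lt_zero) γ₀ n
  rw [sizePMF, hpgf, iteratedDeriv_comp_sub_const]
  simp only [φ, zero_sub, hderiv, neg_one_mul]

namespace IsCompletelyRandomMeasure

variable {S Ω : Type*} [MeasurableSpace S] [MeasurableSpace Ω] {P : Measure S}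
  {G : S → Measure Ω} {ρ : Measure ℝ} {G₀ : Measure Ω}

theorem measurable_real (hG : IsCompletelyRandomMeasure P G ρ G₀) {A : Set Ω}
    (hA : MeasurableSet A) : Measurable fun s => (G s).real A :=
  (hG.measurable_eval A hA).ennreal_toReal

theorem iIndepFun_real (hG : IsCompletelyRandomMeasure P G ρ G₀) {ι : Type*} [Finite ι]
    {A : ι → Set Ω} (hA : ∀ i, MeasurableSet (A i)) (hdisj : Pairwise (Function.onFun Disjoint A)) :
    iIndepFun (fun i s => (G s).real (A i)) P := by
  obtain ⟨n, ⟨e⟩⟩ := Finite.exists_equiv_fin ι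
  have hfin := hG.indep n (A ∘ e.symm) (fun i => hA _)
    (hdisj.comp_of_injective e.symm.injective)
  simpa [Function.comp_def, Measure.real] using (hfin.precomp e.injective).comp
    (fun _ => ENNReal.toReal) fun _ => ENNReal.measurable_toReal

variable [IsProbabilityMeasure P]

theorem mgf_eq (hG : IsCompletelyRandomMeasure P G ρ G₀) (hρ : IsLevyMeasure ρ) {A : Set Ω}
    (hA : MeasurableSet A) {t : ℝ} (ht : t ≤ 0) :
    mgf (fun s => (G s).real A) P t =
      Real.exp (G₀.real A * ∫ r, (Real.exp (t * r) - 1) ∂ρ) := by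
  refine mgf_eq_exp_of_characteristic (hG.measurable_real hA).aemeasurable
    (Eventually.of_forall fun _ => measureReal_nonneg) hρ measureReal_nonneg (fun u => ?_) ht
  refine (hG.characteristic A hA u).trans ?_
  rw [setIntegral_const, levyExponent, Complex.real_smul]

theorem integral_pow_mul_exp (hG : IsCompletelyRandomMeasure P G ρ G₀) (hρ : IsLevyMeasure ρ)
    {A : Set Ω} (hA : MeasurableSet A) {t : ℝ} (ht : t < 0) (n : ℕ) :
    ∫ s, (G s).real A ^ n * Real.exp (t * (G s).real A) ∂P =
      (bellPolynomial (tiltedMoment ρ t) n).eval (G₀.real A) *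
        Real.exp (G₀.real A * ∫ r, (Real.exp (t * r) - 1) ∂ρ) :=
  CountMixture.integral_pow_mul_exp hρ (fun _ ht => integrable_exp_mul_of_nonpos
      (hG.measurable_real hA).aemeasurable
      (Eventually.of_forall fun _ => measureReal_nonneg) ht.le)
    (fun _ ht => hG.mgf_eq hρ hA ht.le) ht n

theorem sizePMF_eq_integral (hG : IsCompletelyRandomMeasure P G ρ G₀) (hρ : IsLevyMeasure ρ)
    (n : ℕ) :
    sizePMF (G₀.real Set.univ) ρ n =
      ∫ s, (G s).real Set.univ ^ n * Real.exp (-(G s).real Set.univ) / n.factorial ∂P := by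
  have h := hG.integral_pow_mul_exp hρ .univ neg_one_lt_zero n
  simp only [neg_one_mul] at h
  rw [sizePMF_eq_eval_bellPolynomial hρ, integral_div, h]

variable [IsFiniteMeasure G₀]

theorem integral_prod_pow_mul_exp_of_iUnion_eq_univ (hG : IsCompletelyRandomMeasure P G ρ G₀)
    (hρ : IsLevyMeasure ρ) {ι : Type*} [Fintype ι] {A : ι → Set Ω} (hA : ∀ i, MeasurableSet (A i))
    (hdisj : Pairwise (Function.onFun Disjoint A)) (hcover : ⋃ i, A i = Set.univ) {t : ℝ}
    (ht : t < 0) (n : ι → ℕ) :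
    ∫ s, (∏ i, (G s).real (A i) ^ n i) * Real.exp (t * (G s).real Set.univ) ∂P =
      (∏ i, (bellPolynomial (tiltedMoment ρ t) (n i)).eval (G₀.real (A i))) *
        Real.exp (G₀.real Set.univ * ∫ r, (Real.exp (t * r) - 1) ∂ρ) := by
  have hsplit : ∀ᵐ s ∂P, (∏ i, (G s).real (A i) ^ n i) * Real.exp (t * (G s).real Set.univ) =
      ∏ i, (G s).real (A i) ^ n i * Real.exp (t * (G s).real (A i)) := by
    filter_upwards [hG.ae_finite] with s hs
    have : IsFiniteMeasure (G s) := ⟨hs⟩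
    rw [← hcover, measureReal_iUnion_fintype hdisj hA, Finset.mul_sum, Real.exp_sum,
      Finset.prod_mul_distrib]
  rw [integral_congr_ae hsplit, (hG.iIndepFun_real hA hdisj).integral_fun_prod_comp
      (f := fun i y => y ^ n i * Real.exp (t * y))
      (fun i => (hG.measurable_real (hA i)).aemeasurable)
      (fun i => by fun_prop), Finset.prod_congr rfl fun i _ =>
      hG.integral_pow_mul_exp hρ (hA i) ht (n i), Finset.prod_mul_distrib, ← Real.exp_sum,
    ← Finset.sum_mul, ← measureReal_iUnion_fintype hdisj hA, hcover]

theorem integral_prod_pow_mul_exp (hG : IsCompletelyRandomMeasure P G ρ G₀)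
    (hρ : IsLevyMeasure ρ) {α : Type*} [Fintype α] {D : α → Set Ω} (hD : ∀ k, MeasurableSet (D k))
    (hdisj : Pairwise (Function.onFun Disjoint D)) {t : ℝ} (ht : t < 0) (n : α → ℕ) :
    ∫ s, (∏ k, (G s).real (D k) ^ n k) * Real.exp (t * (G s).real Set.univ) ∂P =
      (∏ k, (bellPolynomial (tiltedMoment ρ t) (n k)).eval (G₀.real (D k))) *
        Real.exp (G₀.real Set.univ * ∫ r, (Real.exp (t * r) - 1) ∂ρ) := by
  have hcompl : ∀ k, Disjoint (⋃ k, D k)ᶜ (D k) := fun k =>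
    (Set.subset_iUnion D k).disjoint_compl_left
  have h := hG.integral_prod_pow_mul_exp_of_iUnion_eq_univ hρ
    (A := fun o : Option α => o.elim (⋃ k, D k)ᶜ D) (n := fun o => o.elim 0 n)
    (Option.forall.2 ⟨(MeasurableSet.iUnion hD).compl, hD⟩)
    (by
      rintro (_ | j) (_ | k) hjk
      · exact absurd rfl hjk
      · exact hcompl k
      · exact (hcompl j).symm
      · exact hdisj fun h => hjk (congrArg some h))
    (by rw [Set.iUnion_option]; exact Set.compl_union_self _) ht
  simpa [Fintype.prod_option, bellPolynomial_zero] using h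

end IsCompletelyRandomMeasure

/-! ### Sampling the atoms -/

theorem tsum_pi_prod_eq_prod_tsum {n : ℕ} (a : Fin n → ℕ → ℝ≥0∞) :
    ∑' y : Fin n → ℕ, ∏ i, a i (y i) = ∏ i, ∑' k, a i k := by
  induction n with
  | zero => simp
  | succ n ih =>
    rw [← (Fin.consEquiv fun _ : Fin (n + 1) => ℕ).tsum_eq, ENNReal.tsum_prod', Fin.prod_univ_succ,
      ← ih, ← ENNReal.tsum_mul_right]
    refine tsum_congr fun k => ?_
    rw [← ENNReal.tsum_mul_left]
    refine tsum_congr fun y => ?_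
    simp [Fin.prod_univ_succ, Fin.consEquiv]

theorem atomicMeasure_apply {Ω : Type*} [MeasurableSpace Ω] (r : ℕ → ℝ≥0) (ω : ℕ → Ω) {A : Set Ω}
    (hA : MeasurableSet A) :
    atomicMeasure r ω A = ∑' k, (r k : ℝ≥0∞) * A.indicator 1 (ω k) := by
  simp only [atomicMeasure, Measure.sum_apply _ hA, Measure.smul_apply,
    Measure.dirac_apply' _ hA, smul_eq_mul]

theorem atomicMeasure_univ {Ω : Type*} [MeasurableSpace Ω] (r : ℕ → ℝ≥0) (ω : ℕ → Ω) :
    atomicMeasure r ω Set.univ = ∑' k, (r k : ℝ≥0∞) := by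
  simp [atomicMeasure_apply r ω MeasurableSet.univ]

theorem likelihood_eq {r : ℕ → ℝ≥0} (hr : Summable r) {n : ℕ} (y : Fin n → ℕ) :
    likelihood r y = ENNReal.ofReal (Real.exp (-(∑' k, r k : ℝ≥0)) / n.factorial) *
      ∏ i, (r (y i) : ℝ≥0∞) := by
  set T : ℝ≥0 := ∑' k, r k
  have prod_div_mul_pow : (∏ i, ((r (y i) / T : ℝ≥0) : ℝ≥0∞)) * (T : ℝ≥0∞) ^ n =
      ∏ i, (r (y i) : ℝ≥0∞) := by
    rw [← Fin.prod_const, ← Finset.prod_mul_distrib]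
    refine Finset.prod_congr rfl fun i _ => ?_
    rw [← ENNReal.coe_mul, div_mul_cancel_of_imp]
    exact fun hT => hr.tsum_eq_zero_iff.1 hT (y i)
  rw [likelihood, poissonMeasure_singleton, ← prod_div_mul_pow, mul_div_right_comm,
    ENNReal.ofReal_mul (by positivity), ← NNReal.coe_pow, ENNReal.ofReal_coe_nnreal,
    ENNReal.coe_pow]
  ring

theorem likelihood_eq_zero {r : ℕ → ℝ≥0} {n : ℕ} {y : Fin n → ℕ} {i : Fin n} (hi : r (y i) = 0) :
    likelihood r y = 0 :=
  mul_eq_zero_of_right _ (Finset.prod_eq_zero (Finset.mem_univ i) (by simp [hi]))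

theorem measurable_likelihood {n : ℕ} (y : Fin n → ℕ) :
    Measurable fun r : ℕ → ℝ≥0 => likelihood r y := by
  have : Measurable fun r : ℕ → ℝ≥0 => ∑' k, r k :=
    Measurable.tsum fun k => measurable_pi_apply k
  simp only [likelihood, poissonMeasure_singleton]
  fun_prop

theorem tsum_likelihood_mul_indicator {Ω : Type*} [MeasurableSpace Ω] {r : ℕ → ℝ≥0}
    (hr : Summable r) (ω : ℕ → Ω) {n : ℕ} {D : Fin n → Set Ω} (hD : ∀ i, MeasurableSet (D i)) :
    ∑' y : Fin n → ℕ, likelihood r y * (Set.univ.pi D).indicator 1 (fun i => ω (y i)) =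
      ENNReal.ofReal (Real.exp (-(∑' k, r k : ℝ≥0)) / n.factorial) *
        ∏ i, atomicMeasure r ω (D i) := by
  have indicator_pi (w : Fin n → Ω) :
      (Set.univ.pi D).indicator (1 : (Fin n → Ω) → ℝ≥0∞) w = ∏ i, (D i).indicator 1 (w i) := by
    rw [← Finset.coe_univ, Set.indicator_pi_one_apply]
  simp only [atomicMeasure_apply r ω (hD _), ← tsum_pi_prod_eq_prod_tsum, ← ENNReal.tsum_mul_left,
    likelihood_eq hr, indicator_pi, Finset.prod_mul_distrib, mul_assoc]

section Sampling

variable {S Ω X : Type*} [MeasurableSpace S] [MeasurableSpace Ω] [MeasurableSpace X]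

/-- The random weights and atoms `(rₖ, ωₖ)ₖ`, on which the sampling is conditioned. -/
def weightedAtoms (r : ℕ → S → ℝ≥0) (ω : ℕ → S → Ω) (s : S) : (ℕ → ℝ≥0) × (ℕ → Ω) :=
  (fun k => r k s, fun k => ω k s)

/-- The atoms `ω_{z₁}, …, ω_{zₙ}` of the first `n` observations. -/
def sampledAtoms (ω : ℕ → S → Ω) (z : ℕ → S → ℕ) (n : ℕ) (s : S) (i : Fin n) : Ω :=
  ω (z i s) s

/-- The law of the atoms of the observations on the event that the sample size is `n`; its total
mass is the probability of that event. -/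
def sampledAtomLaw (P : Measure S) (ω : ℕ → S → Ω) (m : S → ℕ) (z : ℕ → S → ℕ) (n : ℕ) :
    Measure (Fin n → Ω) :=
  (P.restrict {s | m s = n}).map (sampledAtoms ω z n)

variable {P : Measure S} {ρ : Measure ℝ} {G₀ : Measure Ω} {κ : Kernel Ω X}
  {r : ℕ → S → ℝ≥0} {ω : ℕ → S → Ω} {m : S → ℕ} {z : ℕ → S → ℕ} {x : ℕ → S → X}

instance [IsFiniteMeasure P] (n : ℕ) : IsFiniteMeasure (sampledAtomLaw P ω m z n) := by
  unfold sampledAtomLaw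
  infer_instance

namespace IsCountMixture

theorem measurable_weightedAtoms (h : IsCountMixture P ρ G₀ κ r ω m z x) :
    Measurable (weightedAtoms r ω) :=
  (measurable_pi_lambda _ h.measurable_weight).prodMk (measurable_pi_lambda _ h.measurable_atom)

theorem measurable_sampledAtoms (h : IsCountMixture P ρ G₀ κ r ω m z x) (n : ℕ) :
    Measurable (sampledAtoms ω z n) := by
  have measurable_eval : Measurable fun p : ℕ × S => ω p.1 p.2 :=
    measurable_from_prod_countable_right h.measurable_atom
  exact measurable_pi_lambda _ fun i =>
    measurable_eval.comp ((h.measurable_label i).prodMk measurable_id)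

theorem measurableSet_size (h : IsCountMixture P ρ G₀ κ r ω m z x) (n : ℕ) :
    MeasurableSet {s | m s = n} :=
  h.measurable_size (measurableSet_singleton n)

theorem measurableSet_size_label_obs (h : IsCountMixture P ρ G₀ κ r ω m z x) {n : ℕ}
    (y : Fin n → ℕ) {B : Fin n → Set X} (hB : ∀ i, MeasurableSet (B i)) :
    MeasurableSet {s | m s = n ∧ (∀ i : Fin n, z i s = y i) ∧ ∀ i : Fin n, x i s ∈ B i} := by
  simp only [Set.ofPred_and, Set.ofPred_forall]
  exact (h.measurableSet_size n).inter
    ((MeasurableSet.iInter fun i : Fin n => h.measurable_label i (measurableSet_singleton _)).inter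
      (MeasurableSet.iInter fun i : Fin n => h.measurable_obs i (hB i)))

theorem setLIntegral_weightedAtoms (h : IsCountMixture P ρ G₀ κ r ω m z x) {n : ℕ}
    (y : Fin n → ℕ) {B : Fin n → Set X} (hB : ∀ i, MeasurableSet (B i))
    {g : (ℕ → ℝ≥0) × (ℕ → Ω) → ℝ≥0∞} (hg : Measurable g) :
    ∫⁻ s in {s | m s = n ∧ (∀ i : Fin n, z i s = y i) ∧ ∀ i : Fin n, x i s ∈ B i},
        g (weightedAtoms r ω s) ∂P =
      ∫⁻ s, likelihood (fun k => r k s) y * (∏ i, κ (ω (y i) s) (B i)) *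
        g (weightedAtoms r ω s) ∂P := by
  set E := {s | m s = n ∧ (∀ i : Fin n, z i s = y i) ∧ ∀ i : Fin n, x i s ∈ B i}
  set L : S → ℝ≥0∞ := fun s => likelihood (fun k => r k s) y * ∏ i, κ (ω (y i) s) (B i)
  have hW := h.measurable_weightedAtoms
  have hL : Measurable L :=
    ((measurable_likelihood y).comp (measurable_pi_lambda _ h.measurable_weight)).mul
      (Finset.measurable_prod _ fun i _ =>
        (κ.measurable_coe (hB i)).comp (h.measurable_atom (y i)))
  have map_eq : (P.restrict E).map (weightedAtoms r ω) =
      (P.withDensity L).map (weightedAtoms r ω) := by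
    ext A hA
    rw [Measure.map_apply hW hA, Measure.map_apply hW hA, withDensity_apply _ (hW hA),
      Measure.restrict_apply (hW hA)]
    exact h.conditional_law n y B hB A hA
  rw [← lintegral_map hg hW, map_eq, lintegral_map hg hW]
  exact lintegral_withDensity_eq_lintegral_mul P hL (hg.comp hW)

theorem setLIntegral_sampledAtoms_eq_tsum (h : IsCountMixture P ρ G₀ κ r ω m z x) {n : ℕ}
    {B : Fin n → Set X} (hB : ∀ i, MeasurableSet (B i)) {g : (Fin n → Ω) → ℝ≥0∞}
    (hg : Measurable g) :
    ∫⁻ s in {s | m s = n ∧ ∀ i : Fin n, x i s ∈ B i}, g (sampledAtoms ω z n s) ∂P =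
      ∑' y : Fin n → ℕ, ∫⁻ s, likelihood (fun k => r k s) y * (∏ i, κ (ω (y i) s) (B i)) *
        g (fun i => ω (y i) s) ∂P := by
  have eq_iUnion : {s | m s = n ∧ ∀ i : Fin n, x i s ∈ B i} = ⋃ y : Fin n → ℕ,
      {s | m s = n ∧ (∀ i : Fin n, z i s = y i) ∧ ∀ i : Fin n, x i s ∈ B i} := by
    ext s
    simp only [Set.mem_ofPred_eq, Set.mem_iUnion]
    exact ⟨fun hs => ⟨fun i => z i s, hs.1, fun _ => rfl, hs.2⟩, fun ⟨_, hs⟩ => ⟨hs.1, hs.2.2⟩⟩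
  rw [eq_iUnion, lintegral_iUnion fun y => h.measurableSet_size_label_obs y hB]
  · refine tsum_congr fun y => ?_
    refine Eq.trans (setLIntegral_congr_fun (h.measurableSet_size_label_obs y hB) fun s hs => ?_)
      (h.setLIntegral_weightedAtoms y hB (g := fun p => g fun i => p.2 (y i)) (by fun_prop))
    simp only [weightedAtoms, ← hs.2.1]
    rfl
  · refine fun y y' hy => Set.disjoint_left.2 fun s hs hs' => hy (funext fun i => ?_)
    exact (hs.2.1 i).symm.trans (hs'.2.1 i)

theorem lintegral_sampledAtomLaw (h : IsCountMixture P ρ G₀ κ r ω m z x) [IsMarkovKernel κ]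
    {n : ℕ} {g : (Fin n → Ω) → ℝ≥0∞} (hg : Measurable g) :
    ∫⁻ w, g w ∂sampledAtomLaw P ω m z n =
      ∑' y : Fin n → ℕ, ∫⁻ s, likelihood (fun k => r k s) y * g (fun i => ω (y i) s) ∂P := by
  rw [sampledAtomLaw, lintegral_map hg (h.measurable_sampledAtoms n)]
  simpa using h.setLIntegral_sampledAtoms_eq_tsum (B := fun _ => Set.univ)
    (fun _ => MeasurableSet.univ) hg

theorem measure_sampledAtoms_obs (h : IsCountMixture P ρ G₀ κ r ω m z x) [IsMarkovKernel κ]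
    {n : ℕ} {C : Set (Fin n → Ω)} (hC : MeasurableSet C) {B : Fin n → Set X}
    (hB : ∀ i, MeasurableSet (B i)) :
    P {s | m s = n ∧ sampledAtoms ω z n s ∈ C ∧ ∀ i : Fin n, x i s ∈ B i} =
      ∫⁻ w in C, ∏ i, κ (w i) (B i) ∂sampledAtomLaw P ω m z n := by
  have hκ : Measurable fun w : Fin n → Ω => ∏ i, κ (w i) (B i) :=
    Finset.measurable_prod _ fun i _ => (κ.measurable_coe (hB i)).comp (measurable_pi_apply i)
  have hC₁ : Measurable (C.indicator (1 : (Fin n → Ω) → ℝ≥0∞)) := measurable_one.indicator hC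
  have hCS := h.measurable_sampledAtoms n hC
  calc P {s | m s = n ∧ sampledAtoms ω z n s ∈ C ∧ ∀ i : Fin n, x i s ∈ B i}
      = ∫⁻ s in {s | m s = n ∧ ∀ i : Fin n, x i s ∈ B i},
          C.indicator 1 (sampledAtoms ω z n s) ∂P := by
        rw [show (fun s => C.indicator (1 : (Fin n → Ω) → ℝ≥0∞) (sampledAtoms ω z n s)) =
          (sampledAtoms ω z n ⁻¹' C).indicator 1 from rfl, lintegral_indicator_one hCS,
          Measure.restrict_apply hCS]
        congr 1
        ext s
        simp only [Set.mem_ofPred_eq, Set.mem_inter_iff, Set.mem_preimage]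
        tauto
    _ = ∫⁻ w, (∏ i, κ (w i) (B i)) * C.indicator 1 w ∂sampledAtomLaw P ω m z n := by
        rw [h.setLIntegral_sampledAtoms_eq_tsum hB hC₁]
        simp only [mul_assoc]
        exact (h.lintegral_sampledAtomLaw (hκ.mul hC₁)).symm
    _ = ∫⁻ w in C, ∏ i, κ (w i) (B i) ∂sampledAtomLaw P ω m z n := by
        rw [← lintegral_indicator hC]
        refine lintegral_congr fun w => ?_
        by_cases hw : w ∈ C <;> simp [hw]

theorem ae_weight_pos_of_label (h : IsCountMixture P ρ G₀ κ r ω m z x) {n : ℕ} (y : Fin n → ℕ)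
    (i : Fin n) : ∀ᵐ s ∂P, m s = n → (∀ j : Fin n, z j s = y j) → 0 < r (y i) s := by
  have hA : MeasurableSet {p : (ℕ → ℝ≥0) × (ℕ → Ω) | p.1 (y i) = 0} :=
    ((measurable_pi_apply (y i)).comp measurable_fst) (measurableSet_singleton 0)
  have hlaw := h.conditional_law n y (fun _ => Set.univ) (fun _ => MeasurableSet.univ) _ hA
  have lintegral_eq_zero : ∫⁻ s in weightedAtoms r ω ⁻¹' {p | p.1 (y i) = 0},
      likelihood (fun k => r k s) y * ∏ i : Fin n, κ (ω (y i) s) Set.univ ∂P = 0 := by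
    rw [setLIntegral_congr_fun (g := 0) (h.measurable_weightedAtoms hA) fun s hs => ?_]
    · simp
    · simp only [likelihood_eq_zero (r := fun k => r k s) hs, zero_mul, Pi.zero_apply]
  refine measure_mono_null (fun s hs => ?_) (hlaw.trans lintegral_eq_zero)
  simp only [Set.mem_compl_iff, Set.mem_ofPred_eq, Classical.not_imp, not_lt, nonpos_iff_eq_zero]
    at hs
  exact ⟨hs.2.2, hs.1, hs.2.1, fun _ => Set.mem_univ _⟩

theorem ae_sampledAtoms_eq_iff (h : IsCountMixture P ρ G₀ κ r ω m z x) (n : ℕ) :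
    ∀ᵐ s ∂P, m s = n → ∀ i j : Fin n,
      sampledAtoms ω z n s i = sampledAtoms ω z n s j ↔ z i s = z j s := by
  have weight_pos : ∀ᵐ s ∂P, ∀ (y : Fin n → ℕ) (i : Fin n),
      m s = n → (∀ j : Fin n, z j s = y j) → 0 < r (y i) s :=
    ae_all_iff.2 fun y => ae_all_iff.2 (h.ae_weight_pos_of_label y)
  filter_upwards [weight_pos, h.distinct] with s hpos hdistinct hm i j
  refine ⟨fun heq => ?_, fun hz => by simp only [sampledAtoms, hz]⟩
  by_contra hne
  exact hdistinct _ _ hne (hpos (fun i => z i s) i hm fun _ => rfl)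
    (hpos (fun i => z i s) j hm fun _ => rfl) heq

theorem ae_summable (h : IsCountMixture P ρ G₀ κ r ω m z x) :
    ∀ᵐ s ∂P, Summable fun k => r k s := by
  filter_upwards [h.completelyRandom.ae_finite] with s hs
  rw [atomicMeasure_univ] at hs
  exact ENNReal.tsum_coe_ne_top_iff_summable.1 hs.ne

theorem sampledAtomLaw_pi (h : IsCountMixture P ρ G₀ κ r ω m z x) [IsMarkovKernel κ] {n : ℕ}
    {D : Fin n → Set Ω} (hD : ∀ i, MeasurableSet (D i)) :
    sampledAtomLaw P ω m z n (Set.univ.pi D) =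
      ∫⁻ s, ENNReal.ofReal (Real.exp
          (-(atomicMeasure (fun k => r k s) (fun k => ω k s)).real Set.univ) / n.factorial) *
        ∏ i, atomicMeasure (fun k => r k s) (fun k => ω k s) (D i) ∂P := by
  have hpi : MeasurableSet (Set.univ.pi D) := MeasurableSet.univ_pi hD
  have hind : ∀ y : Fin n → ℕ, Measurable fun p : (ℕ → ℝ≥0) × (ℕ → Ω) =>
      likelihood p.1 y * (Set.univ.pi D).indicator 1 (fun i => p.2 (y i)) := fun y =>
    ((measurable_likelihood y).comp measurable_fst).mul
      ((measurable_one.indicator hpi).comp (by fun_prop))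
  rw [← lintegral_indicator_one hpi, h.lintegral_sampledAtomLaw (measurable_one.indicator hpi)]
  refine (lintegral_tsum fun y =>
    ((hind y).comp h.measurable_weightedAtoms).aemeasurable).symm.trans (lintegral_congr_ae ?_)
  filter_upwards [h.ae_summable] with s hs
  refine (tsum_likelihood_mul_indicator hs (fun k => ω k s) hD).trans ?_
  rw [measureReal_def, atomicMeasure_univ, ← ENNReal.coe_tsum hs, ENNReal.coe_toReal]

theorem sampledAtomLaw_real_pi (h : IsCountMixture P ρ G₀ κ r ω m z x) [IsMarkovKernel κ] {n : ℕ}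
    {D : Fin n → Set Ω} (hD : ∀ i, MeasurableSet (D i)) :
    (sampledAtomLaw P ω m z n).real (Set.univ.pi D) =
      (∫ s, (∏ i, (atomicMeasure (fun k => r k s) (fun k => ω k s)).real (D i)) *
        Real.exp (-(atomicMeasure (fun k => r k s) (fun k => ω k s)).real Set.univ) ∂P) /
        n.factorial := by
  have hmeas := h.completelyRandom.measurable_eval
  have hmeasReal := (hmeas _ MeasurableSet.univ).ennreal_toReal
  simp only [← measureReal_def] at hmeasReal
  rw [measureReal_def, h.sampledAtomLaw_pi hD, ← integral_toReal, ← integral_div]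
  · refine integral_congr_ae (Eventually.of_forall fun s => ?_)
    simp only [ENNReal.toReal_mul, ENNReal.toReal_prod, ← measureReal_def]
    rw [ENNReal.toReal_ofReal (by positivity)]
    ring
  · exact (Measurable.mul (by fun_prop)
      (Finset.measurable_prod _ fun i _ => hmeas _ (hD i))).aemeasurable
  · filter_upwards [h.completelyRandom.ae_finite] with s hs
    exact ENNReal.mul_lt_top ENNReal.ofReal_lt_top
      (ENNReal.prod_lt_top fun i _ => (measure_mono (Set.subset_univ _)).trans_lt hs)

theorem measureReal_size (h : IsCountMixture P ρ G₀ κ r ω m z x) [IsProbabilityMeasure P]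
    [IsMarkovKernel κ] (hρ : IsLevyMeasure ρ) (n : ℕ) :
    P.real {s | m s = n} = sizePMF (G₀.real Set.univ) ρ n := by
  have hpi := h.sampledAtomLaw_real_pi (n := n) (D := fun _ => Set.univ) fun _ => MeasurableSet.univ
  rw [Set.pi_univ, measureReal_def, sampledAtomLaw,
    Measure.map_apply (h.measurable_sampledAtoms n) MeasurableSet.univ, Set.preimage_univ,
    Measure.restrict_apply_univ, ← measureReal_def, ← integral_div] at hpi
  rw [hpi, h.completelyRandom.sizePMF_eq_integral hρ]
  simp

theorem sampledAtomLaw_real_pi_comp (h : IsCountMixture P ρ G₀ κ r ω m z x)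
    [IsProbabilityMeasure P] [IsFiniteMeasure G₀] [IsMarkovKernel κ] (hρ : IsLevyMeasure ρ)
    {n l : ℕ} (q : Fin n → Fin l) {D : Fin l → Set Ω} (hD : ∀ k, MeasurableSet (D k))
    (hdisj : Pairwise (Function.onFun Disjoint D)) :
    (sampledAtomLaw P ω m z n).real (Set.univ.pi fun i => D (q i)) =
      Real.exp (G₀.real Set.univ * ∫ r, (Real.exp (-r) - 1) ∂ρ) / n.factorial *
        ∏ k, (bellPolynomial (tiltedMoment ρ (-1))
          (Finset.univ.filter fun i => q i = k).card).eval (G₀.real (D k)) := by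
  have prod_comp (f : Fin l → ℝ) :
      ∏ i, f (q i) = ∏ k, f k ^ (Finset.univ.filter fun i => q i = k).card := by
    simp only [← Finset.prod_fiberwise' Finset.univ q f, Finset.prod_const]
  have hint := h.completelyRandom.integral_prod_pow_mul_exp hρ hD hdisj (t := -1) (by norm_num)
    fun k => (Finset.univ.filter fun i => q i = k).card
  simp only [neg_one_mul] at hint
  rw [h.sampledAtomLaw_real_pi fun i => hD (q i)]
  simp only [fun s => prod_comp fun k =>
    (atomicMeasure (fun k => r k s) (fun k => ω k s)).real (D k), hint]
  ring

theorem map_restrict_sampledAtomLaw (h : IsCountMixture P ρ G₀ κ r ω m z x)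
    [IsProbabilityMeasure P] [IsFiniteMeasure G₀] [NeZero G₀] [NullSingletonClass G₀]
    [MeasurableSpace.CountablySeparated Ω] [IsMarkovKernel κ] (hρ : IsLevyMeasure ρ) {n l : ℕ}
    {q : Fin n → Fin l} (hq : IsAppearanceOrdered q) {σ : Fin l → Fin n}
    (hσ : ∀ k, q (σ k) = k) :
    ((sampledAtomLaw P ω m z n).restrict (coincidenceSet id q)).map (fun w k => w (σ k)) =
      ENNReal.ofReal (ecpf (G₀.real Set.univ) ρ q) • Measure.pi fun _ => baseLaw G₀ := by
  set c := tiltedMoment ρ (-1)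
  set γ₀ := G₀.real Set.univ
  have card_ne_zero (k : Fin l) : (Finset.univ.filter fun i => q i = k).card ≠ 0 :=
    Finset.card_ne_zero_of_mem (Finset.mem_filter.2 ⟨Finset.mem_univ (σ k), hσ k⟩)
  have ecpf_eq : ecpf γ₀ ρ q = Real.exp (γ₀ * ∫ r, (Real.exp (-r) - 1) ∂ρ) / n.factorial *
      ∏ k, γ₀ * (bellPolynomial c (Finset.univ.filter fun i => q i = k).card).divX.eval
        (γ₀ * 0) := by
    simp only [ecpf, if_pos hq, mul_zero, eval_zero_divX_bellPolynomial c (card_ne_zero _), c,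
      tiltedMoment, neg_one_mul, Finset.prod_mul_distrib, Fin.prod_const]
    ring
  rw [ecpf_eq]
  refine map_restrict_coincidenceSet (baseLaw G₀) (sampledAtomLaw P ω m z n) hσ
    (p := fun k t => γ₀ * (bellPolynomial c (Finset.univ.filter fun i => q i = k).card).divX.eval
      (γ₀ * t)) (fun k => by fun_prop) fun D hD hdisj => ?_
  rw [h.sampledAtomLaw_real_pi_comp hρ q hD hdisj]
  congr! 2 with k
  rw [eval_bellPolynomial_eq_mul_divX c (card_ne_zero k), measureReal_eq_mul_baseLaw G₀ (D k)]
  ring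

end IsCountMixture

end Sampling

/-! ### Labels in order of appearance -/

section Relabelling

theorem label_firstIndex {n : ℕ} (z : Fin n → ℕ) (i : Fin n) : z (firstIndex z i) = z i :=
  (Finset.mem_filter.1 (Finset.min'_mem (Finset.univ.filter fun j => z j = z i) ⟨i, by simp⟩)).2

theorem firstIndex_le {n : ℕ} {z : Fin n → ℕ} {i j : Fin n} (h : z j = z i) :
    firstIndex z i ≤ j :=
  Finset.min'_le _ _ (by simpa using h)

theorem firstIndex_eq_iff {n : ℕ} {z : Fin n → ℕ} {i j : Fin n} :
    firstIndex z i = firstIndex z j ↔ z i = z j := by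
  refine ⟨fun h => ?_, fun h => le_antisymm ?_ ?_⟩
  · rw [← label_firstIndex z i, h, label_firstIndex z]
  · exact firstIndex_le (by rw [label_firstIndex z, h])
  · exact firstIndex_le (by rw [label_firstIndex z, h])

theorem appearance_relabel {n : ℕ} (z : Fin n → ℕ) (i : Fin n) :
    (appearance z (relabel z i) : Fin n) = firstIndex z i := by
  simp [relabel]

theorem relabel_eq_iff {n : ℕ} {z : Fin n → ℕ} {i j : Fin n} :
    relabel z i = relabel z j ↔ z i = z j := by
  rw [← firstIndex_eq_iff, relabel, relabel, (appearance z).symm.injective.eq_iff, Subtype.ext_iff]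

theorem relabel_appearance {n : ℕ} (z : Fin n → ℕ) (k : Fin (numClusters z)) :
    relabel z (appearance z k : Fin n) = k := by
  obtain ⟨i, -, hi⟩ := Finset.mem_image.1 (appearance z k).2
  refine (appearance z).injective (Subtype.ext ?_)
  rw [appearance_relabel, ← hi, firstIndex_eq_iff, label_firstIndex z]

theorem isAppearanceOrdered_relabel {n : ℕ} (z : Fin n → ℕ) : IsAppearanceOrdered (relabel z) := by
  refine ⟨fun k => ⟨_, relabel_appearance z k⟩, fun j k hjk =>
    ⟨appearance z j, relabel_appearance z j, fun i hi => ?_⟩⟩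
  have hlt : (appearance z j : Fin n) < appearance z k := (appearance z).lt_iff_lt.2 hjk
  rw [← hi, appearance_relabel] at hlt
  exact hlt.trans_le (firstIndex_le rfl)

namespace IsAppearanceOrdered

theorem lt_iff {n l : ℕ} {q : Fin n → Fin l} (hq : IsAppearanceOrdered q) {i j : Fin n} :
    q i < q j ↔ ∃ i', q i' = q i ∧ ∀ j', q j' = q j → i' < j' := by
  refine ⟨hq.2 _ _, fun ⟨i', hi', hlt⟩ => lt_of_not_ge fun hji => ?_⟩
  rcases hji.lt_or_eq with hji | hji
  · obtain ⟨j', hj', hlt'⟩ := hq.2 _ _ hji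
    exact lt_asymm (hlt j' hj') (hlt' i' hi')
  · exact lt_irrefl i' (hlt i' (hi'.trans hji.symm))

theorem eq_of_coincidences {n l l' : ℕ} {q : Fin n → Fin l} {q' : Fin n → Fin l'}
    (hq : IsAppearanceOrdered q) (hq' : IsAppearanceOrdered q')
    (h : ∀ i j, q i = q j ↔ q' i = q' j) : (⟨l, q⟩ : Labels n) = ⟨l', q'⟩ := by
  set τ : Fin l → Fin l' := fun k => q' (Function.surjInv hq.1 k)
  have hτ (i : Fin n) : τ (q i) = q' i := (h _ _).1 (Function.surjInv_eq hq.1 _)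
  have strictMono_τ : StrictMono τ := by
    intro j k hjk
    obtain ⟨i, rfl⟩ := hq.1 j
    obtain ⟨i', rfl⟩ := hq.1 k
    rw [hτ, hτ, hq'.lt_iff]
    simpa only [h] using hq.lt_iff.1 hjk
  have surjective_τ : Function.Surjective τ := fun k => by
    obtain ⟨i, rfl⟩ := hq'.1 k
    exact ⟨q i, hτ i⟩
  obtain rfl : l = l' := by
    simpa using Fintype.card_of_bijective (f := τ) ⟨strictMono_τ.injective, surjective_τ⟩
  have τ_eq_id (k : Fin l) : τ k = k :=
    DFunLike.congr_fun (Subsingleton.elim (StrictMono.orderIsoOfSurjective τ strictMono_τ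
      surjective_τ) (OrderIso.refl (Fin l))) k
  rw [show q = q' from funext fun i => by rw [← hτ i, τ_eq_id]]

end IsAppearanceOrdered

theorem relabel_eq_labels_iff {n : ℕ} {z : Fin n → ℕ} {q : Labels n}
    (hq : IsAppearanceOrdered q.2) :
    (⟨_, relabel z⟩ : Labels n) = q ↔ ∀ i j, z i = z j ↔ q.2 i = q.2 j := by
  constructor
  · rintro rfl i j
    exact relabel_eq_iff.symm
  · exact fun h => (isAppearanceOrdered_relabel z).eq_of_coincidences hq
      fun i j => relabel_eq_iff.trans (h i j)

theorem outcome_eq_of_relabel_eq {Ω X : Type*} {n : ℕ} {z : Fin n → ℕ} {q : Labels n}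
    (h : (⟨_, relabel z⟩ : Labels n) = q) {σ : Fin q.1 → Fin n} (hσ : ∀ k, q.2 (σ k) = k)
    (ω : ℕ → Ω) (x : Fin n → X) :
    outcome ω z x = ⟨(n, q.1), q.2, fun k => ω (z (σ k)), x⟩ := by
  subst h
  have atoms_eq : (fun k => ω (originalLabel z k)) = fun k => ω (z (σ k)) := by
    funext k
    rw [originalLabel, relabel_eq_iff.1 ((relabel_appearance z k).trans (hσ k).symm)]
  rw [outcome, atoms_eq]

end Relabelling

/-! ### Measures on the space of outcomes -/

section TwoStep

theorem measurable_sigmaMk {α : Type*} {β : α → Type*} [∀ a, MeasurableSpace (β a)] (a : α) :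
    Measurable (Sigma.mk a : β a → Sigma β) :=
  fun _ hs => MeasurableSpace.measurableSet_iInf.1 hs a

instance (n : ℕ) : DiscreteMeasurableSpace (Labels n) :=
  ⟨fun s => MeasurableSpace.measurableSet_iInf.2 fun l =>
    (MeasurableSet.of_discrete : MeasurableSet (Sigma.mk l ⁻¹' s))⟩

theorem ext_prod_pi {α X ι : Type*} [MeasurableSpace α] [MeasurableSpace X] [Finite ι]
    {μ ν : Measure (α × (ι → X))} [IsFiniteMeasure μ]
    (h : ∀ (C : Set α) (B : ι → Set X), MeasurableSet C → (∀ i, MeasurableSet (B i)) →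
      μ (C ×ˢ Set.univ.pi B) = ν (C ×ˢ Set.univ.pi B)) : μ = ν := by
  refine Measure.ext_prod fun {C t} hC ht => ?_
  have snd_restrict_apply (η : Measure (α × (ι → X))) {t : Set (ι → X)} (ht : MeasurableSet t) :
      (η.restrict (C ×ˢ Set.univ)).snd t = η (C ×ˢ t) := by
    rw [Measure.snd_apply ht, Measure.restrict_apply (measurable_snd ht), Set.inter_comm,
      Set.prod_univ, ← Set.prod_eq]
  have snd_restrict_eq : (μ.restrict (C ×ˢ Set.univ)).snd = (ν.restrict (C ×ˢ Set.univ)).snd :=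
    ext_univ_pi fun B hB => by
      rw [snd_restrict_apply μ (.univ_pi hB), snd_restrict_apply ν (.univ_pi hB), h C B hC hB]
  rw [← snd_restrict_apply μ ht, ← snd_restrict_apply ν ht, snd_restrict_eq]

theorem map_restrict_compProd {α β γ : Type*} [MeasurableSpace α] [MeasurableSpace β]
    [MeasurableSpace γ] {M : Measure α} [IsFiniteMeasure M] {η : Kernel α γ} [IsFiniteKernel η]
    {η' : Kernel β γ} [IsSFiniteKernel η'] {f : α → β} (hf : Measurable f) {T : Set α}
    (hT : MeasurableSet T) (h : ∀ a ∈ T, η a = η' (f a)) :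
    ((M ⊗ₘ η).restrict (T ×ˢ Set.univ)).map (Prod.map f id) = (M.restrict T).map f ⊗ₘ η' := by
  have hfid : Measurable (Prod.map f (id : γ → γ)) := hf.prodMap measurable_id
  refine Measure.ext_prod fun {C D} hC hD => ?_
  have preimage_inter_prod : Prod.map f id ⁻¹' C ×ˢ D ∩ T ×ˢ Set.univ = (f ⁻¹' C ∩ T) ×ˢ D := by
    ext
    simp [and_right_comm]
  rw [Measure.map_apply hfid (hC.prod hD), Measure.restrict_apply (hfid (hC.prod hD)),
    preimage_inter_prod, Measure.compProd_apply_prod ((hf hC).inter hT) hD,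
    Measure.compProd_apply_prod hC hD, setLIntegral_map hC (η'.measurable_coe hD) hf,
    Measure.restrict_restrict (hf hC)]
  exact setLIntegral_congr_fun ((hf hC).inter hT) fun a ha => by rw [h a ha.2]

variable {Ω X : Type*} [MeasurableSpace Ω] [MeasurableSpace X]

theorem observationKernel_apply (κ : Kernel Ω X) [IsMarkovKernel κ] {n l : ℕ} (q : Fin n → Fin l)
    (v : Fin l → Ω) : observationKernel κ q v = Measure.pi fun i => κ (v (q i)) := rfl

instance (κ : Kernel Ω X) [IsMarkovKernel κ] {n l : ℕ} (q : Fin n → Fin l) :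
    IsMarkovKernel (observationKernel κ q) :=
  ⟨fun v => by rw [observationKernel_apply]; infer_instance⟩

theorem measurable_outcome_mk {n l : ℕ} (q : Fin n → Fin l) :
    Measurable fun wx : (Fin l → Ω) × (Fin n → X) => (⟨(n, l), q, wx.1, wx.2⟩ : Outcome Ω X) :=
  (measurable_sigmaMk (β := fun p : ℕ × ℕ =>
    (Fin p.1 → Fin p.2) × (Fin p.2 → Ω) × (Fin p.1 → X)) (n, l)).comp (by fun_prop)

instance (G₀ : Measure Ω) [IsFiniteMeasure G₀] [NeZero G₀]
    (κ : Kernel Ω X) [IsMarkovKernel κ] {n l : ℕ} (q : Fin n → Fin l) :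
    IsProbabilityMeasure (outcomeLaw G₀ κ q) :=
  Measure.isProbabilityMeasure_map (measurable_outcome_mk q).aemeasurable

theorem twoStepLaw_apply (ρ : Measure ℝ) (G₀ : Measure Ω) (κ : Kernel Ω X) [IsMarkovKernel κ]
    {A : Set (Outcome Ω X)} (hA : MeasurableSet A) :
    twoStepLaw ρ G₀ κ A = ∑' (n : ℕ) (q : Labels n),
      ENNReal.ofReal (sizePMF (G₀.real Set.univ) ρ n) *
        (ENNReal.ofReal (eppf (G₀.real Set.univ) ρ q.2) * outcomeLaw G₀ κ q.2 A) := by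
  rw [twoStepLaw, Measure.bind_apply hA measurable_from_nat.aemeasurable, sizeLaw,
    lintegral_sum_measure]
  refine tsum_congr fun n => ?_
  rw [lintegral_smul_measure, lintegral_dirac,
    Measure.bind_apply hA (Measurable.of_discrete).aemeasurable, labelLaw, lintegral_sum_measure,
    smul_eq_mul, ← ENNReal.tsum_mul_left]
  refine tsum_congr fun q => ?_
  rw [lintegral_smul_measure, lintegral_dirac, smul_eq_mul]

end TwoStep

/-! ### The law of the outcome -/

section Outcome

variable {S Ω X : Type*}

/-- The event that the sample size is `n` and that the labels in order of appearance are `q`. -/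
def labelEvent (m : S → ℕ) (z : ℕ → S → ℕ) {n : ℕ} (q : Labels n) : Set S :=
  {s | m s = n ∧ (⟨_, relabel fun i : Fin n => z i s⟩ : Labels n) = q}

/-- The outcome of the count-mixture model as a random element: the sample size, the relabelled
labels and atoms, and the observations. -/
def sampledOutcome (ω : ℕ → S → Ω) (m : S → ℕ) (z : ℕ → S → ℕ) (x : ℕ → S → X) (s : S) :
    Outcome Ω X :=
  outcome (fun k => ω k s) (fun i : Fin (m s) => z i s) fun i : Fin (m s) => x i s

variable {ω : ℕ → S → Ω} {m : S → ℕ} {z : ℕ → S → ℕ} {x : ℕ → S → X}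

theorem eqOn_sampledOutcome_labelEvent {n : ℕ} {q : Labels n} {σ : Fin q.1 → Fin n}
    (hσ : ∀ k, q.2 (σ k) = k) :
    Set.EqOn (sampledOutcome ω m z x)
      ((fun wx => ⟨(n, q.1), q.2, wx.1, wx.2⟩) ∘
        fun s => (fun k => sampledAtoms ω z n s (σ k), fun i : Fin n => x i s))
      (labelEvent m z q) := by
  rintro s ⟨rfl, hq⟩
  exact outcome_eq_of_relabel_eq hq hσ _ _

theorem labelEvent_eq_empty {n : ℕ} {q : Labels n} (hq : ¬ IsAppearanceOrdered q.2) :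
    labelEvent m z q = (∅ : Set S) :=
  Set.eq_empty_of_forall_notMem fun _ hs => hq (hs.2 ▸ isAppearanceOrdered_relabel _)

theorem iUnion_labelEvent (m : S → ℕ) (z : ℕ → S → ℕ) (n : ℕ) :
    ⋃ q : Labels n, labelEvent m z q = {s | m s = n} := by
  ext s
  simp only [Set.mem_iUnion, labelEvent, Set.mem_ofPred_eq]
  exact ⟨fun ⟨_, hm, _⟩ => hm, fun hm => ⟨_, hm, rfl⟩⟩

theorem pairwise_disjoint_labelEvent (m : S → ℕ) (z : ℕ → S → ℕ) (n : ℕ) :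
    Pairwise (Function.onFun Disjoint fun q : Labels n => labelEvent m z q) :=
  fun _ _ hne => Set.disjoint_left.2 fun _ hs hs' => hne (hs.2.symm.trans hs'.2)

theorem hasSum_toReal_of_tsum_eq {ι : Type*} {f : ι → ℝ≥0∞} {a : ℝ≥0∞} (h : ∑' i, f i = a)
    (ha : a ≠ ∞) : HasSum (fun i => (f i).toReal) a.toReal := by
  rw [← h, ENNReal.tsum_toReal_eq (ENNReal.ne_top_of_tsum_ne_top (h.trans_ne ha))]
  exact ENNReal.hasSum_toReal (h.trans_ne ha)

theorem ecpf_nonneg {ρ : Measure ℝ} (hρ : IsLevyMeasure ρ) {γ : ℝ} (hγ : 0 ≤ γ) {n l : ℕ}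
    (q : Fin n → Fin l) : 0 ≤ ecpf γ ρ q := by
  rw [ecpf]
  split_ifs
  · refine mul_nonneg (by positivity) (Finset.prod_nonneg fun k _ => integral_nonneg_of_ae ?_)
    filter_upwards [hρ.ae_pos] with r hr
    positivity
  · exact le_rfl

variable [MeasurableSpace S] [MeasurableSpace Ω] [MeasurableSpace X]
  {P : Measure S} {ρ : Measure ℝ} {G₀ : Measure Ω} {κ : Kernel Ω X} {r : ℕ → S → ℝ≥0}

namespace IsCountMixture

theorem measurableSet_labelEvent (h : IsCountMixture P ρ G₀ κ r ω m z x) {n : ℕ} (q : Labels n) :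
    MeasurableSet (labelEvent m z q) := by
  have measurable_labels : Measurable fun s (i : Fin n) => z i s :=
    measurable_pi_lambda _ fun i => h.measurable_label i
  exact (h.measurableSet_size n).inter
    (measurable_labels (MeasurableSet.of_discrete (s := {y | (⟨_, relabel y⟩ : Labels n) = q})))

theorem labelEvent_ae_eq (h : IsCountMixture P ρ G₀ κ r ω m z x) {n : ℕ} {q : Labels n}
    (hq : IsAppearanceOrdered q.2) :
    labelEvent m z q =ᵐ[P] ({s | m s = n} ∩
      sampledAtoms ω z n ⁻¹' coincidenceSet id q.2 : Set S) := by
  refine eventuallyEq_set.2 ?_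
  filter_upwards [h.ae_sampledAtoms_eq_iff n] with s hs
  refine and_congr_right fun hm => ?_
  rw [relabel_eq_labels_iff hq, Set.mem_preimage, mem_coincidenceSet]
  exact forall₂_congr fun i j => by rw [id_eq, id_eq, hs hm i j]

theorem measurable_obs_pi (h : IsCountMixture P ρ G₀ κ r ω m z x) (n : ℕ) :
    Measurable fun s (i : Fin n) => x i s :=
  measurable_pi_lambda _ fun i => h.measurable_obs i

theorem measurable_clusters_obs (h : IsCountMixture P ρ G₀ κ r ω m z x) {n l : ℕ}
    (σ : Fin l → Fin n) :
    Measurable fun s => (fun k => sampledAtoms ω z n s (σ k), fun i : Fin n => x i s) :=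
  (measurable_pi_lambda _ fun k =>
    (measurable_pi_apply (σ k)).comp (h.measurable_sampledAtoms n)).prodMk (h.measurable_obs_pi n)

theorem measurableSet_labelEvent_inter_preimage (h : IsCountMixture P ρ G₀ κ r ω m z x) {n : ℕ}
    (q : Labels n) {A : Set (Outcome Ω X)} (hA : MeasurableSet A) :
    MeasurableSet (labelEvent m z q ∩ sampledOutcome ω m z x ⁻¹' A) := by
  by_cases hq : IsAppearanceOrdered q.2
  · rw [(eqOn_sampledOutcome_labelEvent (Function.surjInv_eq hq.1)).inter_preimage_eq]
    exact (h.measurableSet_labelEvent q).inter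
      (((measurable_outcome_mk q.2).comp (h.measurable_clusters_obs _)) hA)
  · simp [labelEvent_eq_empty hq]

theorem measurable_sampledOutcome (h : IsCountMixture P ρ G₀ κ r ω m z x) :
    Measurable (sampledOutcome ω m z x) := by
  intro A hA
  have preimage_eq : sampledOutcome ω m z x ⁻¹' A =
      ⋃ n, ⋃ q : Labels n, labelEvent m z q ∩ sampledOutcome ω m z x ⁻¹' A := by
    simp only [← Set.iUnion_inter, iUnion_labelEvent]
    ext
    simp
  rw [preimage_eq]
  exact .iUnion fun n => .iUnion fun q => h.measurableSet_labelEvent_inter_preimage q hA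

theorem tsum_measure_size (h : IsCountMixture P ρ G₀ κ r ω m z x) (μ : Measure S) :
    ∑' n, μ {s | m s = n} = μ Set.univ := by
  rw [← measure_iUnion _ h.measurableSet_size]
  · congr 1
    ext
    simp
  · exact fun _ _ hne => Set.disjoint_left.2 fun _ hs hs' => hne (hs.symm.trans hs')

theorem tsum_measure_labelEvent (h : IsCountMixture P ρ G₀ κ r ω m z x) (μ : Measure S) (n : ℕ) :
    ∑' q : Labels n, μ (labelEvent m z q) = μ {s | m s = n} := by
  rw [← iUnion_labelEvent m z n, measure_iUnion (pairwise_disjoint_labelEvent m z n)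
    h.measurableSet_labelEvent]

variable [IsMarkovKernel κ]

theorem sizePMF_nonneg (h : IsCountMixture P ρ G₀ κ r ω m z x) [IsProbabilityMeasure P]
    (hρ : IsLevyMeasure ρ) (n : ℕ) : 0 ≤ sizePMF (G₀.real Set.univ) ρ n := by
  rw [← h.measureReal_size hρ]
  exact measureReal_nonneg

theorem measure_size (h : IsCountMixture P ρ G₀ κ r ω m z x) [IsProbabilityMeasure P]
    (hρ : IsLevyMeasure ρ) (n : ℕ) :
    P {s | m s = n} = ENNReal.ofReal (sizePMF (G₀.real Set.univ) ρ n) := by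
  rw [← h.measureReal_size hρ, ofReal_measureReal]

theorem hasSum_sizePMF (h : IsCountMixture P ρ G₀ κ r ω m z x) [IsProbabilityMeasure P]
    (hρ : IsLevyMeasure ρ) : HasSum (sizePMF (G₀.real Set.univ) ρ) 1 := by
  have hsum := hasSum_toReal_of_tsum_eq (h.tsum_measure_size P) (measure_ne_top P _)
  simpa only [measure_univ, ENNReal.toReal_one, ← measureReal_def, h.measureReal_size hρ] using hsum

theorem map_size (h : IsCountMixture P ρ G₀ κ r ω m z x) [IsProbabilityMeasure P]
    (hρ : IsLevyMeasure ρ) : P.map m = sizeLaw (G₀.real Set.univ) ρ := by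
  refine Measure.ext_of_singleton fun n => ?_
  rw [Measure.map_apply h.measurable_size (measurableSet_singleton n), sizeLaw,
    Measure.sum_smul_dirac_singleton]
  exact h.measure_size hρ n

theorem map_sampledAtoms_obs (h : IsCountMixture P ρ G₀ κ r ω m z x) [IsFiniteMeasure P] (n : ℕ) :
    (P.restrict {s | m s = n}).map (fun s => (sampledAtoms ω z n s, fun i : Fin n => x i s)) =
      sampledAtomLaw P ω m z n ⊗ₘ observationKernel κ id := by
  have hmeas := (h.measurable_sampledAtoms n).prodMk (h.measurable_obs_pi n)
  refine ext_prod_pi fun C B hC hB => ?_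
  have hCB := hC.prod (MeasurableSet.univ_pi hB)
  rw [Measure.compProd_apply_prod hC (.univ_pi hB), Measure.map_apply hmeas hCB,
    Measure.restrict_apply (hmeas hCB)]
  simp only [observationKernel_apply, Measure.pi_pi, id_eq]
  rw [← h.measure_sampledAtoms_obs hC hB]
  congr 1
  ext s
  simp only [Set.mem_inter_iff, Set.mem_preimage, Set.mem_prod, Set.mem_univ_pi,
    Set.mem_ofPred_eq, and_comm]

variable [IsProbabilityMeasure P] [IsFiniteMeasure G₀] [NeZero G₀] [NullSingletonClass G₀]
  [MeasurableSpace.CountablySeparated Ω]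

theorem map_restrict_labelEvent (h : IsCountMixture P ρ G₀ κ r ω m z x)
    (hρ : IsLevyMeasure ρ) {n : ℕ} {q : Labels n} (hq : IsAppearanceOrdered q.2)
    {σ : Fin q.1 → Fin n} (hσ : ∀ k, q.2 (σ k) = k) :
    (P.restrict (labelEvent m z q)).map
        (fun s => (fun k => sampledAtoms ω z n s (σ k), fun i : Fin n => x i s)) =
      ENNReal.ofReal (ecpf (G₀.real Set.univ) ρ q.2) •
        ((Measure.pi fun _ : Fin q.1 => baseLaw G₀) ⊗ₘ observationKernel κ q.2) := by
  have := measurableEq_of_countablySeparated Ω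
  set C : Set (Fin n → Ω) := coincidenceSet id q.2
  have hC : MeasurableSet C := measurableSet_coincidenceSet measurable_id q.2
  have hpick : Measurable fun (w : Fin n → Ω) k => w (σ k) := by fun_prop
  have hmeas := (h.measurable_sampledAtoms n).prodMk (h.measurable_obs_pi n)
  have restrict_eq : P.restrict (labelEvent m z q) = (P.restrict {s | m s = n}).restrict
      ((fun s => (sampledAtoms ω z n s, fun i : Fin n => x i s)) ⁻¹' C ×ˢ Set.univ) := by
    rw [Measure.restrict_restrict (hmeas (hC.prod .univ)), Set.inter_comm]
    refine Measure.restrict_congr_set ((h.labelEvent_ae_eq hq).trans (.of_eq ?_))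
    rw [Set.prod_univ]
    rfl
  have kernel_eq : ∀ w ∈ C, observationKernel κ id w =
      observationKernel κ q.2 fun k => w (σ k) := fun w hw => by
    simp only [observationKernel_apply, id_eq]
    exact congrArg Measure.pi (funext fun i => congrArg κ ((hw i _).2 (hσ (q.2 i)).symm))
  have hmap := map_restrict_compProd (M := sampledAtomLaw P ω m z n) hpick hC kernel_eq
  rw [h.map_restrict_sampledAtomLaw hρ hq hσ, Measure.compProd_smul_left,
    ← h.map_sampledAtoms_obs, Measure.restrict_map hmeas (hC.prod .univ), ← restrict_eq,
    Measure.map_map (hpick.prodMap measurable_id) hmeas] at hmap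
  exact hmap

theorem map_restrict_sampledOutcome (h : IsCountMixture P ρ G₀ κ r ω m z x)
    (hρ : IsLevyMeasure ρ) {n : ℕ} (q : Labels n) :
    (P.restrict (labelEvent m z q)).map (sampledOutcome ω m z x) =
      ENNReal.ofReal (ecpf (G₀.real Set.univ) ρ q.2) • outcomeLaw G₀ κ q.2 := by
  by_cases hq : IsAppearanceOrdered q.2
  · have hσ := Function.surjInv_eq hq.1
    rw [Measure.map_congr (ae_restrict_of_forall_mem (h.measurableSet_labelEvent q)
        (eqOn_sampledOutcome_labelEvent hσ)),
      ← Measure.map_map (measurable_outcome_mk q.2) (h.measurable_clusters_obs _),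
      h.map_restrict_labelEvent hρ hq hσ, Measure.map_smul, outcomeLaw]
  · simp [labelEvent_eq_empty hq, ecpf, hq]

theorem measure_labelEvent (h : IsCountMixture P ρ G₀ κ r ω m z x) (hρ : IsLevyMeasure ρ)
    {n : ℕ} (q : Labels n) :
    P (labelEvent m z q) = ENNReal.ofReal (ecpf (G₀.real Set.univ) ρ q.2) := by
  have hmap := congrArg (fun μ => μ Set.univ) (h.map_restrict_sampledOutcome hρ q)
  simpa [Measure.map_apply h.measurable_sampledOutcome] using hmap

theorem measureReal_labelEvent (h : IsCountMixture P ρ G₀ κ r ω m z x) (hρ : IsLevyMeasure ρ)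
    {n : ℕ} (q : Labels n) :
    P.real (labelEvent m z q) = ecpf (G₀.real Set.univ) ρ q.2 := by
  rw [measureReal_def, h.measure_labelEvent hρ,
    ENNReal.toReal_ofReal (ecpf_nonneg hρ measureReal_nonneg _)]

theorem sizePMF_mul_eppf (h : IsCountMixture P ρ G₀ κ r ω m z x) (hρ : IsLevyMeasure ρ)
    {n : ℕ} (q : Labels n) :
    sizePMF (G₀.real Set.univ) ρ n * eppf (G₀.real Set.univ) ρ q.2 =
      ecpf (G₀.real Set.univ) ρ q.2 := by
  refine mul_div_cancel_of_imp' fun h0 => ?_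
  rw [← h.measureReal_size hρ] at h0
  rw [← h.measureReal_labelEvent hρ]
  exact measureReal_mono_null (fun s hs => hs.1) h0

theorem hasSum_eppf (h : IsCountMixture P ρ G₀ κ r ω m z x) (hρ : IsLevyMeasure ρ) {n : ℕ}
    (hn : sizePMF (G₀.real Set.univ) ρ n ≠ 0) :
    HasSum (fun q : Labels n => eppf (G₀.real Set.univ) ρ q.2) 1 := by
  have hsum := hasSum_toReal_of_tsum_eq (h.tsum_measure_labelEvent P n) (measure_ne_top P _)
  simp only [← measureReal_def, h.measureReal_labelEvent hρ, h.measureReal_size hρ] at hsum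
  simpa only [div_self hn, eppf] using hsum.div_const (sizePMF (G₀.real Set.univ) ρ n)

theorem cond_size_labelEvent (h : IsCountMixture P ρ G₀ κ r ω m z x) (hρ : IsLevyMeasure ρ)
    {n : ℕ} (hn : sizePMF (G₀.real Set.univ) ρ n ≠ 0) (q : Labels n) :
    (ProbabilityTheory.cond P {s | m s = n})
      {s | (⟨_, relabel fun i : Fin n => z i s⟩ : Labels n) = q} =
        ENNReal.ofReal (eppf (G₀.real Set.univ) ρ q.2) := by
  rw [cond_apply (h.measurableSet_size n), ← Set.ofPred_and, ← labelEvent, h.measure_labelEvent hρ,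
    h.measure_size hρ, eppf, ENNReal.ofReal_div_of_pos ((h.sizePMF_nonneg hρ n).lt_of_ne' hn),
    mul_comm, div_eq_mul_inv]

theorem map_sampledOutcome (h : IsCountMixture P ρ G₀ κ r ω m z x) (hρ : IsLevyMeasure ρ) :
    P.map (sampledOutcome ω m z x) = twoStepLaw ρ G₀ κ := by
  ext A hA
  have hpre := h.measurable_sampledOutcome hA
  have measure_inter {n : ℕ} (q : Labels n) :
      P (labelEvent m z q ∩ sampledOutcome ω m z x ⁻¹' A) =
        ENNReal.ofReal (sizePMF (G₀.real Set.univ) ρ n) *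
          (ENNReal.ofReal (eppf (G₀.real Set.univ) ρ q.2) * outcomeLaw G₀ κ q.2 A) := by
    rw [Set.inter_comm, ← Measure.restrict_apply hpre,
      ← Measure.map_apply h.measurable_sampledOutcome hA, h.map_restrict_sampledOutcome hρ,
      ← h.sizePMF_mul_eppf hρ q, ENNReal.ofReal_mul (h.sizePMF_nonneg hρ n), Measure.smul_apply,
      smul_eq_mul, mul_assoc]
  calc P.map (sampledOutcome ω m z x) A
      = P.restrict (sampledOutcome ω m z x ⁻¹' A) Set.univ := by
        rw [Measure.map_apply h.measurable_sampledOutcome hA, Measure.restrict_apply_univ]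
    _ = ∑' (n : ℕ) (q : Labels n), P (labelEvent m z q ∩ sampledOutcome ω m z x ⁻¹' A) := by
        simp only [← h.tsum_measure_size, ← h.tsum_measure_labelEvent,
          Measure.restrict_apply (h.measurableSet_labelEvent _)]
    _ = twoStepLaw ρ G₀ κ A := by simp only [measure_inter, twoStepLaw_apply ρ G₀ κ hA]

end IsCountMixture

end Outcome

end CountMixture

end

theorem mainTheorem6 {S Ω X : Type*} [MeasurableSpace S] [MeasurableSpace Ω]
    [MeasurableSpace.CountablySeparated Ω] [MeasurableSpace X]
    (P : Measure S) [IsProbabilityMeasure P]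
    (ρ : Measure ℝ) (hρ : CountMixture.IsLevyMeasure ρ)
    (G₀ : Measure Ω) [IsFiniteMeasure G₀] [NullSingletonClass G₀] (hG₀ : G₀ ≠ 0)
    (κ : Kernel Ω X) [IsMarkovKernel κ]
    (r : ℕ → S → ℝ≥0) (ω : ℕ → S → Ω) (m : S → ℕ) (z : ℕ → S → ℕ) (x : ℕ → S → X)
    (hmodel : CountMixture.IsCountMixture P ρ G₀ κ r ω m z x) :
    -- `f_M` is a probability mass function, and it is the marginal law of the sample size
    (∀ n, 0 ≤ CountMixture.sizePMF (G₀.real Set.univ) ρ n) ∧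
    HasSum (CountMixture.sizePMF (G₀.real Set.univ) ρ) 1 ∧
    P.map m = CountMixture.sizeLaw (G₀.real Set.univ) ρ ∧
    -- the EPPF is a probability mass function, and it is the conditional law of the labels
    (∀ (n l : ℕ) (y : Fin n → Fin l), 0 ≤ CountMixture.eppf (G₀.real Set.univ) ρ y) ∧
    (∀ n, CountMixture.sizePMF (G₀.real Set.univ) ρ n ≠ 0 →
      HasSum (fun q : CountMixture.Labels n =>
        CountMixture.eppf (G₀.real Set.univ) ρ q.2) 1) ∧
    (∀ n, CountMixture.sizePMF (G₀.real Set.univ) ρ n ≠ 0 → ∀ q : CountMixture.Labels n,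
      (ProbabilityTheory.cond P {s | m s = n})
        {s | (⟨_, CountMixture.relabel fun i : Fin n => z i s⟩ : CountMixture.Labels n) = q} =
        ENNReal.ofReal (CountMixture.eppf (G₀.real Set.univ) ρ q.2)) ∧
    -- the count-mixture model and the two-step construction have the same law
    P.map (fun s => CountMixture.outcome (fun k => ω k s) (fun i : Fin (m s) => z i s)
      (fun i : Fin (m s) => x i s)) = CountMixture.twoStepLaw ρ G₀ κ := by
  have : NeZero G₀ := ⟨hG₀⟩
  exact ⟨hmodel.sizePMF_nonneg hρ, hmodel.hasSum_sizePMF hρ, hmodel.map_size hρ,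
    fun n _ z => div_nonneg (CountMixture.ecpf_nonneg hρ measureReal_nonneg z)
      (hmodel.sizePMF_nonneg hρ n),
    fun _ hn => hmodel.hasSum_eppf hρ hn, fun _ hn q => hmodel.cond_size_labelEvent hρ hn q,
    hmodel.map_sampledOutcome hρ⟩
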